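/- \textbf{Theorem (PL inequality for $\Phi$).} Let $d\ge 1$ and let $P,Q$ be Borel probability measures on $\mathbb{R}^d$ such that: $P$ has compact convex support $\Omega$ and a Lebesgue density $\rho$ with $\lambda_P\le\rho\le\Lambda_P$ on $\Omega$ for constants $0<\lambda_P<\Lambda_P<\infty$; $Q$ has compact support $\Omega'$. Let $c:\mathbb{R}^d\times\mathbb{R}^d\to\mathbb{R}$ be Lipschitz with constant $L>0$, in the sense that $|c(x,y)-c(x',y')|\le L(\|x-x'\|+\|y-y'\|)$, and let $\varepsilon>0$. Write $B_r(x)$ for the open Euclidean ball, $(u\oplus v)(x,y)=u(x)+v(y)$, $t_+=\max(t,0)$, and let $$\mathrm{QOT}_\varepsilon(P,Q)=\inf_{\pi\in\Pi(P,Q)}\int c\,d\pi+\frac{\varepsilon}{2}\Big\|\frac{d\pi}{d(P\otimes Q)}\Big\|_{L^2(P\otimes Q)}^2,$$ where $\Pi(P,Q)$ is the set of couplings of $P$ and $Q$ and the last term is $+\infty$ if $\pi\not\ll P\otimes Q$. For $(f,g)\in L^2(P)\times L^2(Q)$ let $$\Gamma(f,g)=\int\Big(f\oplus g-\frac{1}{2\varepsilon}(f\oplus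 g-c)_+^2\Big)\,d(P\otimes Q),$$ and let $(f_*,g_*)$ be any maximizer of $\Gamma$ over $L^2(P)\times L^2(Q)$. Let $\mathcal{H}=\{u\oplus v:(u,v)\in L^2(P)\times L^2(Q)\}$, a closed subspace of $L^2(P\otimes Q)$, hence a Hilbert space with the inherited inner product. Define $\Phi:\mathcal{H}\to\mathbb{R}$ by $\Phi(f\oplus g)=\Gamma(f,g)$, and let $\mathrm{D}\Phi$ denote its $\mathcal{H}$-gradient. (i) There is $\delta\in(0,1]$, depending only on $\Omega$ and $\lambda_P$, such that $P(B_r(x))\ge\delta\min(r^d,1)$ for all $r>0$ and $x\in\Omega$. (ii) Let $\delta_P\in(0,1]$ be any constant with $P(B_r(x))\ge\delta_P\min(r^d,1)$ for all $r>0$ and $x\in\Omega$, and set $$\gamma_\varepsilon=16\left(\delta_P^{-1}\max\Big(\frac{8L}{\varepsilon},1\Big)^d\right)\frac{\Lambda_P^2}{\lambda_P^2}\,\frac{\big(\lceil 8L\,\mathrm{diam}(\Omega)/\varepsilon\rceil\big)^{d+2}}{\inf_{y\in\Omega'}Q\big(B_{\varepsilon/(8L)}(y)\big)}.$$ Then for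 all $(f,g)\in L^\infty(P)\times L^\infty(Q)$, the function $f\oplus g-f_*\oplus g_*$ is essentially bounded, $\Phi$ is (Fréchet) differentiable at $f\oplus g$, and, with $\|\cdot\|_\infty$ the norm of $L^\infty(P\otimes Q)$, $$\|f\oplus g-f_*\oplus g_*\|_{L^2(P\otimes Q)}\le\gamma_\varepsilon\max\big(\|f\oplus g-f_*\oplus g_*\|_\infty,\varepsilon\big)\,\|\mathrm{D}\Phi(f\oplus g)\|_{L^2(P\otimes Q)}$$ and $$\|\mathrm{D}\Phi(f\oplus g)\|_{L^2(P\otimes Q)}^2\ge\frac{1}{\gamma_\varepsilon\max\big(\|f\oplus g-f_*\oplus g_*\|_\infty,\varepsilon\big)}\big(\mathrm{QOT}_\varepsilon(P,Q)-\Phi(f\oplus g)\big).$$ -/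

import Mathlib

open MeasureTheory
open scoped ENNReal

noncomputable section

namespace QuadOT

/-! ### Direct sums and the closed subspace `H` of `L²(P ⊗ Q)` -/

section DirectSum

variable {X Y : Type*} [MeasurableSpace X] [MeasurableSpace Y]
  (P : Measure X) (Q : Measure Y) [IsProbabilityMeasure P] [IsProbabilityMeasure Q]

/-- The direct sum `(u ⊕ v)(x, y) = u x + v y` as a linear map
`L²(P) × L²(Q) → L²(P ⊗ Q)`. -/
def oplusₗ : (Lp ℝ 2 P × Lp ℝ 2 Q) →ₗ[ℝ] Lp ℝ 2 (P.prod Q) :=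
  LinearMap.coprod
    (Lp.compMeasurePreservingₗ ℝ Prod.fst
      (measurePreserving_fst : MeasurePreserving Prod.fst (P.prod Q) P))
    (Lp.compMeasurePreservingₗ ℝ Prod.snd
      (measurePreserving_snd : MeasurePreserving Prod.snd (P.prod Q) Q))

/-- The subspace `H = {u ⊕ v : u ∈ L²(P), v ∈ L²(Q)}` of `L²(P ⊗ Q)`, with the inner product
inherited from `L²(P ⊗ Q)`. -/
def H : Submodule ℝ (Lp ℝ 2 (P.prod Q)) := LinearMap.range (oplusₗ P Q)

/-- The direct sum `u ⊕ v` as an element of `H`. -/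
def oplus (u : Lp ℝ 2 P) (v : Lp ℝ 2 Q) : H P Q :=
  ⟨oplusₗ P Q (u, v), LinearMap.mem_range_self _ _⟩

variable {P Q}

theorem coeFn_oplus (u : Lp ℝ 2 P) (v : Lp ℝ 2 Q) :
    ((oplus P Q u v : Lp ℝ 2 (P.prod Q)) : X × Y → ℝ)
      =ᵐ[P.prod Q] fun z => u z.1 + v z.2 := by
  have h1 := Lp.coeFn_compMeasurePreserving u
    (measurePreserving_fst : MeasurePreserving Prod.fst (P.prod Q) P)
  have h2 := Lp.coeFn_compMeasurePreserving v
    (measurePreserving_snd : MeasurePreserving Prod.snd (P.prod Q) Q)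
  filter_upwards [Lp.coeFn_add (Lp.compMeasurePreserving Prod.fst
      (measurePreserving_fst : MeasurePreserving Prod.fst (P.prod Q) P) u)
      (Lp.compMeasurePreserving Prod.snd
      (measurePreserving_snd : MeasurePreserving Prod.snd (P.prod Q) Q) v), h1, h2]
    with z hz h1 h2
  have : (oplus P Q u v : Lp ℝ 2 (P.prod Q)) =
      Lp.compMeasurePreserving Prod.fst
      (measurePreserving_fst : MeasurePreserving Prod.fst (P.prod Q) P) u +
      Lp.compMeasurePreserving Prod.snd
      (measurePreserving_snd : MeasurePreserving Prod.snd (P.prod Q) Q) v := rfl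
  rw [this, hz, Pi.add_apply, h1, h2]
  rfl

variable (P Q)

/-- `H` is closed: it is the range of `(u, v) ↦ u ⊕ v` restricted to `∫ v dQ = 0`, on which
`‖u ⊕ v‖² = ‖u‖² + ‖v‖²`. -/
theorem isClosed_H : IsClosed (H P Q : Set (Lp ℝ 2 (P.prod Q))) := by
  let A := Lp.compMeasurePreservingₗᵢ (E := ℝ) (p := 2) ℝ Prod.fst
      (measurePreserving_fst : MeasurePreserving Prod.fst (P.prod Q) P)
  let B := Lp.compMeasurePreservingₗᵢ (E := ℝ) (p := 2) ℝ Prod.snd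
      (measurePreserving_snd : MeasurePreserving Prod.snd (P.prod Q) Q)
  have hone : ∀ v : Lp ℝ 2 Q, inner ℝ (Lp.const 2 Q (1 : ℝ)) v = ∫ y, v y ∂Q := by
    intro v
    rw [L2.inner_def]
    refine integral_congr_ae ?_
    filter_upwards [Lp.coeFn_const (p := 2) (μ := Q) (1 : ℝ)] with y hy
    rw [hy]
    simp
  let V : Submodule ℝ (Lp ℝ 2 Q) := (innerSL ℝ (Lp.const 2 Q (1 : ℝ))).ker
  have hVc : IsClosed (V : Set (Lp ℝ 2 Q)) :=
    (innerSL ℝ (Lp.const 2 Q (1 : ℝ))).isClosed_ker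
  have : CompleteSpace V := hVc.completeSpace_coe
  let T : (Lp ℝ 2 P × V) →L[ℝ] Lp ℝ 2 (P.prod Q) :=
    A.toContinuousLinearMap.coprod (B.toContinuousLinearMap.comp V.subtypeL)
  have horth : ∀ (u : Lp ℝ 2 P) (v : V), inner ℝ (A u) (B (v : Lp ℝ 2 Q)) = 0 := by
    intro u v
    have hv : ∫ y, (v : Lp ℝ 2 Q) y ∂Q = 0 := by
      rw [← hone]
      exact v.2
    rw [L2.inner_def]
    have : ∫ z, (v : Lp ℝ 2 Q) z.2 * u z.1 ∂(P.prod Q) = 0 := by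
      have := integral_prod_mul (μ := P) (ν := Q) (fun x => u x) (fun y => (v : Lp ℝ 2 Q) y)
      rw [hv, mul_zero] at this
      simpa [mul_comm] using this
    rw [← this]
    refine integral_congr_ae ?_
    filter_upwards [Lp.coeFn_compMeasurePreserving u
        (measurePreserving_fst : MeasurePreserving Prod.fst (P.prod Q) P),
      Lp.coeFn_compMeasurePreserving (v : Lp ℝ 2 Q)
        (measurePreserving_snd : MeasurePreserving Prod.snd (P.prod Q) Q)] with z h1 h2
    change inner ℝ ((Lp.compMeasurePreserving Prod.fst _ u) z)
      ((Lp.compMeasurePreserving Prod.snd _ (v : Lp ℝ 2 Q)) z) = _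
    rw [h1, h2]
    simp
  have hanti : AntilipschitzWith 1 T := by
    refine AddMonoidHomClass.antilipschitz_of_bound T ?_
    rintro ⟨u, v⟩
    have h := norm_add_sq_eq_norm_sq_add_norm_sq_of_inner_eq_zero (A u) (B (v : Lp ℝ 2 Q))
      (horth u v)
    rw [A.norm_map, B.norm_map] at h
    have hT : T (u, v) = A u + B (v : Lp ℝ 2 Q) := rfl
    rw [hT, NNReal.coe_one, one_mul, Prod.norm_def]
    refine max_le ?_ ?_
    · change ‖u‖ ≤ _
      nlinarith [norm_nonneg u, norm_nonneg (v : Lp ℝ 2 Q), norm_nonneg (A u + B (v : Lp ℝ 2 Q))]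
    · change ‖(v : Lp ℝ 2 Q)‖ ≤ _
      nlinarith [norm_nonneg u, norm_nonneg (v : Lp ℝ 2 Q), norm_nonneg (A u + B (v : Lp ℝ 2 Q))]
  have hrange : (H P Q : Set (Lp ℝ 2 (P.prod Q))) = Set.range T := by
    ext w
    constructor
    · rintro ⟨⟨u, v⟩, rfl⟩
      have hmem : v - Lp.const 2 Q (∫ y, v y ∂Q) ∈ V := by
        change inner ℝ (Lp.const 2 Q (1 : ℝ)) (v - Lp.const 2 Q (∫ y, v y ∂Q)) = 0
        rw [inner_sub_right, hone, hone, integral_congr_ae (Lp.coeFn_const (p := 2) (μ := Q) _)]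
        simp
      refine ⟨(u + Lp.const 2 P (∫ y, v y ∂Q), ⟨_, hmem⟩), ?_⟩
      have hAB : A (Lp.const 2 P (∫ y, v y ∂Q)) = B (Lp.const 2 Q (∫ y, v y ∂Q)) := rfl
      change A (u + Lp.const 2 P (∫ y, v y ∂Q)) + B (v - Lp.const 2 Q (∫ y, v y ∂Q)) = A u + B v
      rw [map_add, map_sub, hAB]
      abel
    · rintro ⟨⟨u, v⟩, rfl⟩
      exact ⟨(u, v), rfl⟩
  rw [hrange]
  exact hanti.isClosed_range T.uniformContinuous

instance : CompleteSpace (H P Q) := (isClosed_H P Q).completeSpace_coe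

end DirectSum

/-! ### Primal and dual objectives -/

section Objectives

variable {X Y : Type*} [MeasurableSpace X] [MeasurableSpace Y]

/-- The set `Π(P, Q)` of couplings of `P` and `Q`. -/
def couplings (P : Measure X) (Q : Measure Y) : Set (Measure (X × Y)) :=
  {π | π.map Prod.fst = P ∧ π.map Prod.snd = Q}

open Classical in
/-- The squared norm `‖dπ/d(P ⊗ Q)‖²` in `L²(P ⊗ Q)`, equal to `+∞` if `π` is not absolutely
continuous with respect to `P ⊗ Q`. -/
def sqDensityNorm (P : Measure X) (Q : Measure Y) (π : Measure (X × Y)) : ℝ≥0∞ :=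
  if π ≪ P.prod Q then ∫⁻ z, (π.rnDeriv (P.prod Q) z) ^ 2 ∂(P.prod Q) else ⊤

/-- The value `QOT_ε(P, Q)` of the primal quadratically regularized transport problem. -/
def QOT (P : Measure X) (Q : Measure Y) (c : X → Y → ℝ) (ε : ℝ) : EReal :=
  ⨅ π ∈ couplings P Q,
    ((∫ z, c z.1 z.2 ∂π : ℝ) : EReal)
      + ((ENNReal.ofReal (ε / 2) * sqDensityNorm P Q π : ℝ≥0∞) : EReal)

/-- The dual objective `Γ(f, g)` on `L²(P) × L²(Q)`. -/
def Gam (P : Measure X) (Q : Measure Y) (c : X → Y → ℝ) (ε : ℝ)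
    (f : Lp ℝ 2 P) (g : Lp ℝ 2 Q) : ℝ :=
  ∫ z, (f z.1 + g z.2 - 1 / (2 * ε) * (max (f z.1 + g z.2 - c z.1 z.2) 0) ^ 2) ∂(P.prod Q)

/-- `(f, g)` is an optimizer of the dual problem `sup Γ` over `L²(P) × L²(Q)`. -/
def IsDualOptimizer (P : Measure X) (Q : Measure Y) (c : X → Y → ℝ) (ε : ℝ)
    (f : Lp ℝ 2 P) (g : Lp ℝ 2 Q) : Prop :=
  ∀ (f' : Lp ℝ 2 P) (g' : Lp ℝ 2 Q), Gam P Q c ε f' g' ≤ Gam P Q c ε f g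

/-- The reduced dual objective `Φ : H → ℝ`, written directly in terms of `w ∈ H`. -/
def Phi (P : Measure X) (Q : Measure Y) [IsProbabilityMeasure P] [IsProbabilityMeasure Q]
    (c : X → Y → ℝ) (ε : ℝ) (w : H P Q) : ℝ :=
  ∫ z, ((w : Lp ℝ 2 (P.prod Q)) z
    - 1 / (2 * ε) * (max ((w : Lp ℝ 2 (P.prod Q)) z - c z.1 z.2) 0) ^ 2) ∂(P.prod Q)

/-- `Φ(f ⊕ g) = Γ(f, g)`. -/
theorem Phi_oplus (P : Measure X) (Q : Measure Y) [IsProbabilityMeasure P]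
    [IsProbabilityMeasure Q] (c : X → Y → ℝ) (ε : ℝ) (f : Lp ℝ 2 P) (g : Lp ℝ 2 Q) :
    Phi P Q c ε (oplus P Q f g) = Gam P Q c ε f g := by
  refine integral_congr_ae ?_
  filter_upwards [coeFn_oplus f g] with z hz
  rw [hz]

/-- The norm of `L^∞(P ⊗ Q)` (the essential supremum of `|w|`). -/
def supNorm (P : Measure X) (Q : Measure Y) (w : Lp ℝ 2 (P.prod Q)) : ℝ :=
  (eLpNorm w ∞ (P.prod Q)).toReal

end Objectives

/-! ### Marginals on `ℝ^d` and the constant `γ_ε` -/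

section Marginals

variable {d : ℕ}

/-- `P` has a density with respect to Lebesgue measure with values in `[lam, Lam]` on the support
of `P`. -/
def HasDensityBounds (P : Measure (EuclideanSpace ℝ (Fin d))) (lam Lam : ℝ) : Prop :=
  ∃ ρ : EuclideanSpace ℝ (Fin d) → ℝ, Measurable ρ ∧
    P = volume.withDensity (fun x => ENNReal.ofReal (ρ x)) ∧
    ∀ x ∈ P.support, lam ≤ ρ x ∧ ρ x ≤ Lam

/-- `δ ∈ (0, 1]` is such that `P(B_r(x)) ≥ δ min(r^d, 1)` for all `r > 0` and all `x` in the
support of `P`. -/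
def IsBallConstant (P : Measure (EuclideanSpace ℝ (Fin d))) (δ : ℝ) : Prop :=
  0 < δ ∧ δ ≤ 1 ∧
    ∀ r : ℝ, 0 < r → ∀ x ∈ P.support, δ * min (r ^ d) 1 ≤ P.real (Metric.ball x r)

/-- The constant `γ_ε`. -/
def gam (P Q : Measure (EuclideanSpace ℝ (Fin d))) (lam Lam L δ ε : ℝ) : ℝ :=
  16 * (δ⁻¹ * (max (8 * L / ε) 1) ^ d) * (Lam ^ 2 / lam ^ 2)
    * ((⌈8 * L * Metric.diam P.support / ε⌉₊ : ℝ) ^ (d + 2)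
      / ⨅ y : Q.support, Q.real (Metric.ball (y : EuclideanSpace ℝ (Fin d)) (ε / (8 * L))))

end Marginals

end QuadOT

end

/-!
# Error bound and Polyak–Łojasiewicz inequality for quadratically regularized optimal transport

Write `w = f ⊕ g`, `w* = fs ⊕ gs`, `h = w - w*`, and let `A` be the set where the optimal slack
`w* - c` is at least `ε / 2`. The function `Φ` is concave and differentiable on `H`, and its gradient
at `w` is the projection to `H` of `1 - (w - c)₊ / ε` (`hasGradientAt_Phi`). It vanishes at `w*`,
which gives `⟪∇Φ(w), -h⟫ = ε⁻¹ ∫ ((w - c)₊ - (w* - c)₊) h`. The integrand is nonnegative, and on `A`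
it is at least `ε h² / (2 m)` with `m = max(‖h‖_∞, ε)`, since the slack can shrink by `ε / 2` before
the positive part becomes flat. So `∫_A h² ≤ 2 m ‖∇Φ(w)‖ ‖h‖`
(`IsDualOptimizer.setIntegral_sq_le_inner`), and the error bound follows from the coercivity
estimate `‖h‖² ≤ (γ_ε / 2) ∫_A h²` (`IsDualOptimizer.integral_sq_le_setIntegral`).

Coercivity rests on the shape of `A`. The first-order conditions
`∫ (fs x + gs y - c x y)₊ dQ(y) = ε` for almost every `x`, and their counterparts in `y`, make `fs`
and `gs` Lipschitz with the constant `L` of the cost on sets of full measure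
(`abs_sub_le_of_integral_posPart_eq`), and give almost every point of either side a partner with
slack at least `ε`. Hence `A` contains, up to null sets, the product of the balls of radius
`r = ε / (8 L)` around such a pair (`half_le_slack`). Writing `h = u ⊕ v`, averaging over the common
section of `A` bounds the increments of `u` at distance at most `r` by `∫_A h²`
(`mul_lintegral_sq_sub_le`); a nonlocal Poincaré inequality on the convex support of `P`, obtained by
cutting segments into `⌈diam / r⌉` steps, turns this into a bound on the variance of `u`
(`HasDensityBounds.lintegral_sq_sub_le`); and `v` is controlled by `u` and `h` through the sections
of `A` in the other direction (`mul_lintegral_sq_le`).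

For the second inequality, `(w* - c)₊ / ε` is the density of a coupling whose cost is `Φ(w*)`
(`IsDualOptimizer.QOT_le`), so that concavity yields
`QOT_ε(P, Q) - Φ(w) ≤ Φ(w*) - Φ(w) ≤ ‖∇Φ(w)‖ ‖h‖`, and the error bound applies to `‖h‖`.
-/

namespace QuadOT

/-! ### Consequences of the density bounds -/

section Density

variable {d : ℕ} {P : Measure (EuclideanSpace ℝ (Fin d))} {lam Lam : ℝ}

theorem HasDensityBounds.le_smul_restrict (h : HasDensityBounds P lam Lam) :
    P ≤ ENNReal.ofReal Lam • volume.restrict P.support := by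
  obtain ⟨ρ, -, hP, hb⟩ := h
  have hPs : ∀ s, MeasurableSet s → P s = ∫⁻ x in s, ENNReal.ofReal (ρ x) := by
    intro s hs
    rw [hP, withDensity_apply _ hs]
  have hm : MeasurableSet P.support := Measure.isClosed_support.measurableSet
  refine Measure.le_iff.2 fun s hs => ?_
  calc P s = P (s ∩ P.support) := (measure_inter_conull Measure.measure_compl_support).symm
    _ = ∫⁻ x in s ∩ P.support, ENNReal.ofReal (ρ x) := hPs _ (hs.inter hm)
    _ ≤ ∫⁻ _ in s ∩ P.support, ENNReal.ofReal Lam :=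
      setLIntegral_mono measurable_const fun x hx => ENNReal.ofReal_le_ofReal (hb x hx.2).2
    _ = (ENNReal.ofReal Lam • volume.restrict P.support) s := by
      rw [setLIntegral_const, Measure.smul_apply, Measure.restrict_apply hs, smul_eq_mul]

theorem HasDensityBounds.smul_restrict_le (h : HasDensityBounds P lam Lam) :
    ENNReal.ofReal lam • volume.restrict P.support ≤ P := by
  obtain ⟨ρ, hρ, hP, hb⟩ := h
  have hPs : ∀ s, MeasurableSet s → P s = ∫⁻ x in s, ENNReal.ofReal (ρ x) := by
    intro s hs
    rw [hP, withDensity_apply _ hs]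
  have hm : MeasurableSet P.support := Measure.isClosed_support.measurableSet
  refine Measure.le_iff.2 fun s hs => ?_
  calc (ENNReal.ofReal lam • volume.restrict P.support) s
      = ∫⁻ _ in s ∩ P.support, ENNReal.ofReal lam := by
        rw [setLIntegral_const, Measure.smul_apply, Measure.restrict_apply hs, smul_eq_mul]
    _ ≤ ∫⁻ x in s ∩ P.support, ENNReal.ofReal (ρ x) :=
      setLIntegral_mono hρ.ennreal_ofReal fun x hx => ENNReal.ofReal_le_ofReal (hb x hx.2).1
    _ = P (s ∩ P.support) := (hPs _ (hs.inter hm)).symm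
    _ ≤ P s := measure_mono Set.inter_subset_left

theorem HasDensityBounds.absolutelyContinuous (h : HasDensityBounds P lam Lam) :
    P ≪ volume := by
  obtain ⟨ρ, -, hP, -⟩ := h
  rw [hP]
  exact withDensity_absolutelyContinuous _ _

theorem HasDensityBounds.volume_support_pos [IsProbabilityMeasure P]
    (h : HasDensityBounds P lam Lam) : 0 < volume P.support := by
  refine pos_iff_ne_zero.2 fun h0 => ?_
  have h1 := h.absolutelyContinuous h0
  have h2 : P P.support = P Set.univ := measure_of_measure_compl_eq_zero
    Measure.measure_compl_support
  rw [h1, measure_univ] at h2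
  exact zero_ne_one h2

/-- In positive dimension a support of positive volume is not a point. -/
theorem HasDensityBounds.diam_support_pos [IsProbabilityMeasure P] (hd : 1 ≤ d)
    (h : HasDensityBounds P lam Lam) (hc : IsCompact P.support) :
    0 < Metric.diam P.support := by
  refine Metric.diam_pos ?_ hc.isBounded
  rw [← Set.not_subsingleton_iff]
  intro hs
  have : Nonempty (Fin d) := ⟨⟨0, hd⟩⟩
  exact h.volume_support_pos.ne' (hs.measure_zero _)

/-- Shrinking a convex compact set `K` by the factor `r / (diam K + 1)` towards a point `x ∈ K`
keeps it inside `K ∩ B_r(x)`, which bounds the volume of the latter from below. -/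
theorem volume_inter_ball_ge {K : Set (EuclideanSpace ℝ (Fin d))} (hK : Convex ℝ K)
    (hKc : IsCompact K) {x : EuclideanSpace ℝ (Fin d)} (hx : x ∈ K) {r : ℝ} (hr : 0 < r)
    (hr1 : r ≤ 1) :
    ENNReal.ofReal ((r / (Metric.diam K + 1)) ^ d) * volume K ≤
      volume (K ∩ Metric.ball x r) := by
  have hD : 0 ≤ Metric.diam K := Metric.diam_nonneg
  set t := r / (Metric.diam K + 1) with ht
  have ht0 : 0 < t := by positivity
  have ht1 : t ≤ 1 := by
    rw [ht, div_le_one (by positivity)]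
    linarith
  have htr : t * (Metric.diam K + 1) = r := by
    rw [ht]; field_simp
  have himg : AffineMap.homothety x t '' K ⊆ K ∩ Metric.ball x r := by
    rintro _ ⟨y, hy, rfl⟩
    refine ⟨?_, ?_⟩
    · rw [AffineMap.homothety_eq_lineMap]
      exact hK.lineMap_mem hx hy ⟨ht0.le, ht1⟩
    · have := Metric.dist_le_diam_of_mem hKc.isBounded hy hx
      rw [Metric.mem_ball, dist_homothety_center, Real.norm_of_nonneg ht0.le, dist_comm x y]
      nlinarith
  calc ENNReal.ofReal (t ^ d) * volume K = volume (AffineMap.homothety x t '' K) := by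
        rw [Measure.addHaar_image_homothety, finrank_euclideanSpace, Fintype.card_fin,
          abs_of_nonneg (by positivity)]
    _ ≤ _ := measure_mono himg

/-- A ball constant for a probability measure with density at least `lam` on its convex compact
support `K`; it involves only `K` and `lam`. -/
theorem HasDensityBounds.isBallConstant [IsProbabilityMeasure P] (hlam : 0 < lam)
    (h : HasDensityBounds P lam Lam) (hK : Convex ℝ P.support) (hKc : IsCompact P.support) :
    IsBallConstant P
      (min 1 (lam * volume.real P.support / (Metric.diam P.support + 1) ^ d)) := by
  have hD : 0 ≤ Metric.diam P.support := Metric.diam_nonneg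
  have hfin : volume P.support ≠ ∞ := hKc.measure_lt_top.ne
  have hvol : 0 < volume.real P.support := ENNReal.toReal_pos h.volume_support_pos.ne' hfin
  set δ := min 1 (lam * volume.real P.support / (Metric.diam P.support + 1) ^ d) with hδ
  have hδ0 : 0 < δ := lt_min one_pos (by positivity)
  refine ⟨hδ0, min_le_left _ _, ?_⟩
  have key : ∀ r : ℝ, 0 < r → r ≤ 1 → ∀ x ∈ P.support, δ * r ^ d ≤ P.real (Metric.ball x r) := by
    intro r hr hr1 x hx
    have h1 : ENNReal.ofReal (δ * r ^ d) ≤ P (Metric.ball x r) := by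
      calc ENNReal.ofReal (δ * r ^ d)
          ≤ ENNReal.ofReal (lam * volume.real P.support / (Metric.diam P.support + 1) ^ d
              * r ^ d) := by
            gcongr
            exact min_le_right _ _
        _ = ENNReal.ofReal lam *
            (ENNReal.ofReal ((r / (Metric.diam P.support + 1)) ^ d) * volume P.support) := by
            rw [← ENNReal.ofReal_toReal hfin, ← ENNReal.ofReal_mul (by positivity),
              ← ENNReal.ofReal_mul hlam.le]
            congr 1
            rw [div_pow]
            change _ = lam * (_ * volume.real P.support)
            field_simp
        _ ≤ ENNReal.ofReal lam * volume (P.support ∩ Metric.ball x r) := by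
            gcongr
            exact volume_inter_ball_ge hK hKc hx hr hr1
        _ = (ENNReal.ofReal lam • volume.restrict P.support) (Metric.ball x r) := by
            rw [Measure.smul_apply, Measure.restrict_apply measurableSet_ball, smul_eq_mul,
              Set.inter_comm]
        _ ≤ P (Metric.ball x r) := h.smul_restrict_le _
    exact (ENNReal.ofReal_le_iff_le_toReal (measure_ne_top _ _)).1 h1
  intro r hr x hx
  rcases le_total r 1 with hr1 | hr1
  · refine le_trans ?_ (key r hr hr1 x hx)
    gcongr
    exact min_le_left _ _
  · calc δ * min (r ^ d) 1 ≤ δ * 1 ^ d := by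
          rw [one_pow]
          gcongr
          exact min_le_right _ _
      _ ≤ P.real (Metric.ball x 1) := key 1 one_pos le_rfl x hx
      _ ≤ P.real (Metric.ball x r) := measureReal_mono (Metric.ball_subset_ball hr1)

end Density

/-! ### A nonlocal Poincaré inequality on convex sets -/

section Poincare

variable {E : Type*} [NormedAddCommGroup E] [NormedSpace ℝ E]

/-- Along the segment from `x` to `x + N • w` in a convex set, the increment of `u` is the sum of
`N` increments over steps `w` of length at most `r`. -/
theorem indicator_sq_sub_le_sum {K : Set E} (hK : Convex ℝ K) {r : ℝ} {N : ℕ} (hN : N ≠ 0)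
    (hdiam : ∀ x ∈ K, ∀ y ∈ K, dist x y ≤ N * r) (u : E → ℝ) (x w : E) :
    (K ×ˢ K).indicator (fun z => ENNReal.ofReal ((u z.1 - u z.2) ^ 2)) (x, x + (N : ℝ) • w) ≤
      N * ∑ i ∈ Finset.range N, ((K ×ˢ K) ∩ {z | dist z.1 z.2 ≤ r}).indicator
        (fun z => ENNReal.ofReal ((u z.1 - u z.2) ^ 2))
          (x + (i : ℝ) • w, x + (i : ℝ) • w + w) := by
  by_cases hx : (x, x + (N : ℝ) • w) ∈ K ×ˢ K
  swap
  · rw [Set.indicator_of_notMem hx]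
    exact zero_le
  have hN0 : (0 : ℝ) < N := by positivity
  have hw : ‖w‖ ≤ r := by
    have := hdiam _ hx.1 _ hx.2
    rw [dist_self_add_right, norm_smul, Real.norm_of_nonneg hN0.le] at this
    exact le_of_mul_le_mul_left this hN0
  have hmem : ∀ i : ℕ, i ≤ N → x + (i : ℝ) • w ∈ K := by
    intro i hi
    have := hK.add_smul_sub_mem hx.1 hx.2 (t := (i : ℝ) / N)
      ⟨by positivity, by rw [div_le_one hN0]; exact_mod_cast hi⟩
    simpa [smul_smul, div_mul_cancel₀ _ hN0.ne'] using this
  have hstep : ∀ i : ℕ, x + (i : ℝ) • w + w = x + ((i + 1 : ℕ) : ℝ) • w := by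
    intro i
    push_cast
    rw [add_smul, one_smul, add_assoc]
  have hterm : ∀ i ∈ Finset.range N, ((K ×ˢ K) ∩ {z | dist z.1 z.2 ≤ r}).indicator
        (fun z => ENNReal.ofReal ((u z.1 - u z.2) ^ 2))
          (x + (i : ℝ) • w, x + (i : ℝ) • w + w) =
      ENNReal.ofReal ((u (x + (i : ℝ) • w) - u (x + ((i + 1 : ℕ) : ℝ) • w)) ^ 2) := by
    intro i hi
    rw [Finset.mem_range] at hi
    rw [Set.indicator_of_mem]
    · simp only [hstep]
    · refine ⟨⟨hmem i hi.le, ?_⟩, ?_⟩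
      · simp only [hstep]
        exact hmem _ hi
      · simpa using hw
  rw [Set.indicator_of_mem hx, Finset.sum_congr rfl hterm,
    ← ENNReal.ofReal_sum_of_nonneg (fun i _ => sq_nonneg _), ← ENNReal.ofReal_natCast,
    ← ENNReal.ofReal_mul hN0.le]
  refine ENNReal.ofReal_le_ofReal ?_
  have hsum : u x - u (x + (N : ℝ) • w) = ∑ i ∈ Finset.range N,
      (u (x + (i : ℝ) • w) - u (x + ((i + 1 : ℕ) : ℝ) • w)) := by
    rw [Finset.sum_range_sub' (fun i : ℕ => u (x + (i : ℝ) • w))]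
    simp
  have := sq_sum_le_card_mul_sum_sq (s := Finset.range N)
    (f := fun i => u (x + (i : ℝ) • w) - u (x + ((i + 1 : ℕ) : ℝ) • w))
  rwa [← hsum, Finset.card_range] at this

variable [FiniteDimensional ℝ E] [MeasurableSpace E] [BorelSpace E]

/-- After the substitution `x' = x + N • w`, each of the `N` steps of
`indicator_sq_sub_le_sum` contributes the same integral, by translation invariance in `x`. -/
theorem lintegral_sq_sub_le_of_convex (μ : Measure E) [μ.IsAddHaarMeasure] {K : Set E}
    (hK : Convex ℝ K) (hKm : MeasurableSet K) {r : ℝ} {N : ℕ} (hN : N ≠ 0)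
    (hdiam : ∀ x ∈ K, ∀ y ∈ K, dist x y ≤ N * r) {u : E → ℝ} (hu : Measurable u) :
    ∫⁻ x, ∫⁻ y, (K ×ˢ K).indicator (fun z => ENNReal.ofReal ((u z.1 - u z.2) ^ 2)) (x, y) ∂μ ∂μ ≤
      (N : ℝ≥0∞) ^ (Module.finrank ℝ E + 2) *
        ∫⁻ x, ∫⁻ y, ((K ×ˢ K) ∩ {z | dist z.1 z.2 ≤ r}).indicator
          (fun z => ENNReal.ofReal ((u z.1 - u z.2) ^ 2)) (x, y) ∂μ ∂μ := by
  set n := Module.finrank ℝ E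
  set F : E × E → ℝ≥0∞ := fun z => ENNReal.ofReal ((u z.1 - u z.2) ^ 2) with hF
  set G := (K ×ˢ K).indicator F with hG
  set Gr := ((K ×ˢ K) ∩ {z : E × E | dist z.1 z.2 ≤ r}).indicator F with hGr
  have hFm : Measurable F := by fun_prop
  have hGm : Measurable G := hFm.indicator (hKm.prod hKm)
  have hGrm : Measurable Gr := hFm.indicator
    ((hKm.prod hKm).inter (measurableSet_le (by fun_prop) measurable_const))
  have hN0 : (N : ℝ) ≠ 0 := by exact_mod_cast hN
  have hscale : ∀ f : E → ℝ≥0∞, Measurable f →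
      ∫⁻ y, f y ∂μ = (N : ℝ≥0∞) ^ n * ∫⁻ w, f ((N : ℝ) • w) ∂μ := by
    intro f hf
    have h1 : ∫⁻ w, f ((N : ℝ) • w) ∂μ = ∫⁻ y, f y ∂(μ.map ((N : ℝ) • ·)) :=
      (lintegral_map hf (measurable_const_smul _)).symm
    rw [h1, Measure.map_addHaar_smul μ hN0, lintegral_smul_measure, smul_eq_mul, ← mul_assoc,
      ← ENNReal.ofReal_natCast N, ← ENNReal.ofReal_pow (by positivity),
      ← ENNReal.ofReal_mul (by positivity), abs_of_nonneg (by positivity),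
      mul_inv_cancel₀ (by positivity), ENNReal.ofReal_one, one_mul]
  have hshift : ∀ i : ℕ, ∫⁻ x, ∫⁻ w, Gr (x + (i : ℝ) • w, x + (i : ℝ) • w + w) ∂μ ∂μ =
      ∫⁻ x, ∫⁻ y, Gr (x, y) ∂μ ∂μ := by
    intro i
    calc ∫⁻ x, ∫⁻ w, Gr (x + (i : ℝ) • w, x + (i : ℝ) • w + w) ∂μ ∂μ
        = ∫⁻ w, ∫⁻ x, Gr (x + (i : ℝ) • w, x + (i : ℝ) • w + w) ∂μ ∂μ :=
          lintegral_lintegral_swap (by fun_prop)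
      _ = ∫⁻ w, ∫⁻ x, Gr (x, x + w) ∂μ ∂μ := by
          refine lintegral_congr fun w => ?_
          exact lintegral_add_right_eq_self (fun x => Gr (x, x + w)) _
      _ = ∫⁻ x, ∫⁻ w, Gr (x, x + w) ∂μ ∂μ := lintegral_lintegral_swap (by fun_prop)
      _ = ∫⁻ x, ∫⁻ y, Gr (x, y) ∂μ ∂μ := by
          refine lintegral_congr fun x => ?_
          exact lintegral_add_left_eq_self (fun y => Gr (x, y)) _
  calc ∫⁻ x, ∫⁻ y, G (x, y) ∂μ ∂μ
      = ∫⁻ x, (N : ℝ≥0∞) ^ n * ∫⁻ w, G (x, x + (N : ℝ) • w) ∂μ ∂μ := by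
        refine lintegral_congr fun x => ?_
        rw [← lintegral_add_left_eq_self (fun y => G (x, y)) x]
        exact hscale (fun y => G (x, x + y)) (by fun_prop)
    _ = (N : ℝ≥0∞) ^ n * ∫⁻ x, ∫⁻ w, G (x, x + (N : ℝ) • w) ∂μ ∂μ :=
        lintegral_const_mul' _ _ (ENNReal.pow_ne_top (ENNReal.natCast_ne_top N))
    _ ≤ (N : ℝ≥0∞) ^ n * ∫⁻ x, ∫⁻ w, N * ∑ i ∈ Finset.range N,
          Gr (x + (i : ℝ) • w, x + (i : ℝ) • w + w) ∂μ ∂μ := by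
        gcongr with x w
        exact indicator_sq_sub_le_sum hK hN hdiam u x w
    _ = (N : ℝ≥0∞) ^ n * (N * ∑ i ∈ Finset.range N,
          ∫⁻ x, ∫⁻ w, Gr (x + (i : ℝ) • w, x + (i : ℝ) • w + w) ∂μ ∂μ) := by
        congr 1
        rw [← lintegral_finsetSum _ (fun i _ => by fun_prop),
          ← lintegral_const_mul' _ _ (ENNReal.natCast_ne_top N)]
        refine lintegral_congr fun x => ?_
        rw [lintegral_const_mul' _ _ (ENNReal.natCast_ne_top N),
          lintegral_finsetSum _ (fun i _ => by fun_prop)]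
    _ = (N : ℝ≥0∞) ^ (n + 2) * ∫⁻ x, ∫⁻ y, Gr (x, y) ∂μ ∂μ := by
        rw [Finset.sum_congr rfl fun i _ => hshift i, Finset.sum_const, Finset.card_range,
          nsmul_eq_mul]
        ring

theorem lintegral_lintegral_mono_measure {X : Type*} [MeasurableSpace X] {μ ν : Measure X}
    (h : μ ≤ ν) (f : X → X → ℝ≥0∞) :
    ∫⁻ x, ∫⁻ y, f x y ∂μ ∂μ ≤ ∫⁻ x, ∫⁻ y, f x y ∂ν ∂ν :=
  lintegral_mono' h fun _ => lintegral_mono' h le_rfl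

/-- The nonlocal Poincaré inequality for a measure with density bounds: the constant
`(Lam / lam) ^ 2` comes from comparison with Lebesgue measure. -/
theorem HasDensityBounds.lintegral_sq_sub_le {d : ℕ} {P : Measure (EuclideanSpace ℝ (Fin d))}
    {lam Lam : ℝ} (hlam : 0 < lam) (hLam : 0 ≤ Lam) (h : HasDensityBounds P lam Lam)
    (hK : Convex ℝ P.support) {r : ℝ} {N : ℕ} (hN : N ≠ 0)
    (hdiam : ∀ x ∈ P.support, ∀ y ∈ P.support, dist x y ≤ N * r)
    {u : EuclideanSpace ℝ (Fin d) → ℝ} (hu : Measurable u) :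
    ∫⁻ x, ∫⁻ y, ENNReal.ofReal ((u x - u y) ^ 2) ∂P ∂P ≤
      ENNReal.ofReal (Lam ^ 2 / lam ^ 2 * N ^ (d + 2)) *
        ∫⁻ x, ∫⁻ y, {z : EuclideanSpace ℝ (Fin d) × EuclideanSpace ℝ (Fin d) |
          dist z.1 z.2 ≤ r}.indicator
            (fun z => ENNReal.ofReal ((u z.1 - u z.2) ^ 2)) (x, y) ∂P ∂P := by
  have hm : MeasurableSet P.support := Measure.isClosed_support.measurableSet
  set K := P.support with hKdef
  set F : EuclideanSpace ℝ (Fin d) × EuclideanSpace ℝ (Fin d) → ℝ≥0∞ :=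
    fun z => ENNReal.ofReal ((u z.1 - u z.2) ^ 2) with hF
  set B := {z : EuclideanSpace ℝ (Fin d) × EuclideanSpace ℝ (Fin d) | dist z.1 z.2 ≤ r}
  have hres : ∀ f : EuclideanSpace ℝ (Fin d) × EuclideanSpace ℝ (Fin d) → ℝ≥0∞,
      ∫⁻ x in K, ∫⁻ y in K, f (x, y) = ∫⁻ x, ∫⁻ y, (K ×ˢ K).indicator f (x, y) := by
    intro f
    rw [← lintegral_indicator hm]
    refine lintegral_congr fun x => ?_
    by_cases hx : x ∈ K
    · rw [Set.indicator_of_mem hx, ← lintegral_indicator hm]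
      refine lintegral_congr fun y => ?_
      by_cases hy : y ∈ K <;> simp [hx, hy]
    · simp [hx]
  have hsmul : ∀ (a : ℝ≥0∞) (_ : a ≠ ∞) (f : EuclideanSpace ℝ (Fin d) ×
      EuclideanSpace ℝ (Fin d) → ℝ≥0∞),
      ∫⁻ x, ∫⁻ y, f (x, y) ∂(a • volume.restrict K) ∂(a • volume.restrict K) =
        a ^ 2 * ∫⁻ x in K, ∫⁻ y in K, f (x, y) := by
    intro a ha f
    simp only [lintegral_smul_measure, smul_eq_mul]
    rw [lintegral_const_mul' _ _ ha]
    ring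
  calc ∫⁻ x, ∫⁻ y, F (x, y) ∂P ∂P
      ≤ ENNReal.ofReal Lam ^ 2 * ∫⁻ x in K, ∫⁻ y in K, F (x, y) := by
        rw [← hsmul _ ENNReal.ofReal_ne_top]
        exact lintegral_lintegral_mono_measure h.le_smul_restrict _
    _ ≤ ENNReal.ofReal Lam ^ 2 * ((N : ℝ≥0∞) ^ (d + 2) *
          ∫⁻ x in K, ∫⁻ y in K, B.indicator F (x, y)) := by
        gcongr
        have := lintegral_sq_sub_le_of_convex volume hK hm hN hdiam hu
        rw [finrank_euclideanSpace, Fintype.card_fin] at this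
        rw [hres, hres]
        simpa only [Set.indicator_indicator] using this
    _ = ENNReal.ofReal (Lam ^ 2 / lam ^ 2 * N ^ (d + 2)) * (ENNReal.ofReal lam ^ 2 *
          ∫⁻ x in K, ∫⁻ y in K, B.indicator F (x, y)) := by
        have hconst : ENNReal.ofReal (Lam ^ 2 / lam ^ 2 * N ^ (d + 2)) * ENNReal.ofReal lam ^ 2 =
            ENNReal.ofReal Lam ^ 2 * (N : ℝ≥0∞) ^ (d + 2) := by
          rw [← ENNReal.ofReal_natCast N, ← ENNReal.ofReal_pow (Nat.cast_nonneg N),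
            ← ENNReal.ofReal_pow hlam.le, ← ENNReal.ofReal_pow hLam,
            ← ENNReal.ofReal_mul (by positivity), ← ENNReal.ofReal_mul (by positivity)]
          congr 1
          field_simp
        rw [← mul_assoc, ← mul_assoc, hconst]
    _ ≤ _ := by
        rw [← hsmul _ ENNReal.ofReal_ne_top]
        refine mul_le_mul_right ?_ _
        exact lintegral_lintegral_mono_measure h.smul_restrict_le _

end Poincare

/-! ### Coercivity of direct sums on a set containing many small products -/

section Coercivity

variable {X Y : Type*} [MeasurableSpace X] [MeasurableSpace Y]

theorem memLp_oplus {P : Measure X} {Q : Measure Y} [IsProbabilityMeasure P]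
    [IsProbabilityMeasure Q] {u : X → ℝ} {v : Y → ℝ} {p : ℝ≥0∞} (hu : MemLp u p P)
    (hv : MemLp v p Q) : MemLp (fun z : X × Y => u z.1 + v z.2) p (P.prod Q) :=
  (hu.comp_measurePreserving measurePreserving_fst).add
    (hv.comp_measurePreserving measurePreserving_snd)

theorem integral_sq_add_prod {P : Measure X} {Q : Measure Y} [IsProbabilityMeasure P]
    [IsProbabilityMeasure Q] {u : X → ℝ} {v : Y → ℝ} (hu : MemLp u 2 P) (hv : MemLp v 2 Q) :
    ∫ z, (u z.1 + v z.2) ^ 2 ∂(P.prod Q) =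
      ∫ x, u x ^ 2 ∂P + ∫ y, v y ^ 2 ∂Q + 2 * ((∫ x, u x ∂P) * ∫ y, v y ∂Q) := by
  have hu1 := hu.integrable_sq.comp_fst Q
  have hv1 := hv.integrable_sq.comp_snd P
  have huv1 : Integrable (fun z : X × Y => u z.1 ^ 2 + v z.2 ^ 2) (P.prod Q) := hu1.add hv1
  have huv := (hu.integrable one_le_two).mul_prod (hv.integrable one_le_two)
  have h1 : ∀ z : X × Y, (u z.1 + v z.2) ^ 2 = u z.1 ^ 2 + v z.2 ^ 2 + 2 * (u z.1 * v z.2) :=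
    fun z => by ring
  simp_rw [h1]
  rw [integral_add huv1 (huv.const_mul 2), integral_add hu1 hv1, integral_const_mul,
    integral_prod_mul, integral_fun_fst (fun x => u x ^ 2), integral_fun_snd (fun y => v y ^ 2)]
  simp

theorem ofReal_sq_add_le (a b : ℝ) :
    ENNReal.ofReal ((a + b) ^ 2) ≤ 2 * ENNReal.ofReal (a ^ 2) + 2 * ENNReal.ofReal (b ^ 2) := by
  have h2 : (2 : ℝ≥0∞) = ENNReal.ofReal 2 := by simp
  rw [h2, ← ENNReal.ofReal_mul two_pos.le, ← ENNReal.ofReal_mul two_pos.le,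
    ← ENNReal.ofReal_add (by positivity) (by positivity)]
  exact ENNReal.ofReal_le_ofReal (by nlinarith [sq_nonneg (a - b)])

variable (P : Measure X) (Q : Measure Y) [IsProbabilityMeasure P] [IsProbabilityMeasure Q]
  {u : X → ℝ} {v : Y → ℝ} {A : Set (X × Y)}

/-- If the sections of `A` over two near points `x, x'` share `Q`-mass `q`, then averaging
`u x - u x' = (u x + v y) - (u x' + v y)` over the common `y` controls the increments of `u`
by `u ⊕ v` on `A`. -/
theorem mul_lintegral_sq_sub_le (hu : Measurable u) (hv : Measurable v) (hA : MeasurableSet A)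
    {D : Set (X × X)} {q : ℝ≥0∞} (hqt : q ≠ ∞)
    (hq : ∀ᵐ x ∂P, ∀ᵐ x' ∂P, (x, x') ∈ D → q ≤ Q {y | (x, y) ∈ A ∧ (x', y) ∈ A}) :
    q * ∫⁻ x, ∫⁻ x', D.indicator (fun z => ENNReal.ofReal ((u z.1 - u z.2) ^ 2)) (x, x') ∂P ∂P ≤
      4 * ∫⁻ x, ∫⁻ y, A.indicator (fun z => ENNReal.ofReal ((u z.1 + v z.2) ^ 2)) (x, y) ∂Q ∂P := by
  set F : X × Y → ℝ≥0∞ := A.indicator (fun z => ENNReal.ofReal ((u z.1 + v z.2) ^ 2)) with hF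
  have hFm : Measurable F := Measurable.indicator (by fun_prop) hA
  set a : X → ℝ≥0∞ := fun x => ∫⁻ y, F (x, y) ∂Q with ha
  have ham : Measurable a := hFm.lintegral_prod_right'
  have hpt : ∀ᵐ x ∂P, ∀ᵐ x' ∂P,
      q * D.indicator (fun z => ENNReal.ofReal ((u z.1 - u z.2) ^ 2)) (x, x') ≤
        2 * a x + 2 * a x' := by
    filter_upwards [hq] with x hx
    filter_upwards [hx] with x' hx'
    by_cases hD : (x, x') ∈ D
    swap
    · simp [hD]
    set S := {y | (x, y) ∈ A ∧ (x', y) ∈ A} with hS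
    have hSm : MeasurableSet S :=
      (hA.preimage measurable_prodMk_left).inter (hA.preimage measurable_prodMk_left)
    rw [Set.indicator_of_mem hD]
    calc q * ENNReal.ofReal ((u x - u x') ^ 2)
        ≤ Q S * ENNReal.ofReal ((u x - u x') ^ 2) := by
          gcongr
          exact hx' hD
      _ = ∫⁻ _ in S, ENNReal.ofReal ((u x - u x') ^ 2) ∂Q := by
          rw [setLIntegral_const, mul_comm]
      _ ≤ ∫⁻ y in S, (2 * F (x, y) + 2 * F (x', y)) ∂Q := by
          refine setLIntegral_mono (by fun_prop) fun y hy => ?_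
          rw [hF, Set.indicator_of_mem hy.1, Set.indicator_of_mem hy.2]
          have := ofReal_sq_add_le (u x + v y) (-(u x' + v y))
          rw [neg_sq] at this
          convert this using 3
          ring
      _ ≤ ∫⁻ y, (2 * F (x, y) + 2 * F (x', y)) ∂Q := setLIntegral_le_lintegral _ _
      _ = 2 * a x + 2 * a x' := by
          rw [lintegral_add_left (by fun_prop), lintegral_const_mul _ (by fun_prop),
            lintegral_const_mul _ (by fun_prop)]
  rw [← lintegral_const_mul' _ _ hqt]
  calc ∫⁻ x, q * ∫⁻ x', D.indicator (fun z => ENNReal.ofReal ((u z.1 - u z.2) ^ 2)) (x, x') ∂P ∂P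
      ≤ ∫⁻ x, ∫⁻ x', (2 * a x + 2 * a x') ∂P ∂P := by
        refine lintegral_mono_ae ?_
        filter_upwards [hpt] with x hx
        rw [← lintegral_const_mul' _ _ hqt]
        exact lintegral_mono_ae hx
    _ = 4 * ∫⁻ x, a x ∂P := by
        have h1 : ∀ x, ∫⁻ x', (2 * a x + 2 * a x') ∂P = 2 * a x + 2 * ∫⁻ x', a x' ∂P := by
          intro x
          rw [lintegral_add_left measurable_const, lintegral_const, measure_univ, mul_one,
            lintegral_const_mul _ ham]
        simp_rw [h1]
        rw [lintegral_add_right _ measurable_const, lintegral_const, measure_univ, mul_one,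
          lintegral_const_mul _ ham, ← add_mul]
        norm_num

/-- Averaging `v y = (u x + v y) - u x` over the section of `A` at `y` bounds `v` by `u` and by
`u ⊕ v` on `A`. -/
theorem mul_lintegral_sq_le (hu : Measurable u) (hv : Measurable v) (hA : MeasurableSet A)
    {p : ℝ≥0∞} (hpt : p ≠ ∞) (hp : ∀ᵐ y ∂Q, p ≤ P {x | (x, y) ∈ A}) :
    p * ∫⁻ y, ENNReal.ofReal (v y ^ 2) ∂Q ≤
      2 * ∫⁻ y, ∫⁻ x, A.indicator (fun z => ENNReal.ofReal ((u z.1 + v z.2) ^ 2)) (x, y) ∂P ∂Q +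
        2 * ∫⁻ x, ENNReal.ofReal (u x ^ 2) ∂P := by
  set F : X × Y → ℝ≥0∞ := A.indicator (fun z => ENNReal.ofReal ((u z.1 + v z.2) ^ 2)) with hF
  have hFm : Measurable F := Measurable.indicator (by fun_prop) hA
  have hb : Measurable fun y => ∫⁻ x, F (x, y) ∂P := hFm.lintegral_prod_left'
  rw [← lintegral_const_mul' _ _ hpt]
  calc ∫⁻ y, p * ENNReal.ofReal (v y ^ 2) ∂Q
      ≤ ∫⁻ y, (2 * ∫⁻ x, F (x, y) ∂P + 2 * ∫⁻ x, ENNReal.ofReal (u x ^ 2) ∂P) ∂Q := by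
        refine lintegral_mono_ae ?_
        filter_upwards [hp] with y hy
        set S := {x | (x, y) ∈ A} with hS
        calc p * ENNReal.ofReal (v y ^ 2) ≤ P S * ENNReal.ofReal (v y ^ 2) := by gcongr
          _ = ∫⁻ _ in S, ENNReal.ofReal (v y ^ 2) ∂P := by rw [setLIntegral_const, mul_comm]
          _ ≤ ∫⁻ x in S, (2 * F (x, y) + 2 * ENNReal.ofReal (u x ^ 2)) ∂P := by
              refine setLIntegral_mono (by fun_prop) fun x hx => ?_
              rw [hF, Set.indicator_of_mem (show (x, y) ∈ A from hx)]
              have := ofReal_sq_add_le (u x + v y) (-(u x))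
              rw [neg_sq] at this
              convert this using 3
              ring
          _ ≤ ∫⁻ x, (2 * F (x, y) + 2 * ENNReal.ofReal (u x ^ 2)) ∂P :=
              setLIntegral_le_lintegral _ _
          _ = _ := by
              rw [lintegral_add_left (by fun_prop), lintegral_const_mul _ (by fun_prop),
                lintegral_const_mul _ (by fun_prop)]
    _ = _ := by
        rw [lintegral_add_right _ measurable_const, lintegral_const, measure_univ, mul_one,
          lintegral_const_mul _ hb]

/-- The coercivity estimate for a direct sum whose first component has mean zero, so that
`‖u ⊕ v‖² = ‖u‖² + ‖v‖²`. -/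
theorem integral_sq_le_of_integral_eq_zero (hu : Measurable u) (hv : Measurable v)
    (hu2 : MemLp u 2 P) (hv2 : MemLp v 2 Q) (hmean : ∫ x, u x ∂P = 0) (hA : MeasurableSet A)
    {D : Set (X × X)} {p q K : ℝ} (hp0 : 0 < p) (hp1 : p ≤ 1) (hq0 : 0 < q) (hq1 : q ≤ 1)
    (hK : 1 ≤ K)
    (hpoinc : ∫⁻ x, ∫⁻ x', ENNReal.ofReal ((u x - u x') ^ 2) ∂P ∂P ≤ ENNReal.ofReal K *
      ∫⁻ x, ∫⁻ x', D.indicator (fun z => ENNReal.ofReal ((u z.1 - u z.2) ^ 2)) (x, x') ∂P ∂P)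
    (hq : ∀ᵐ x ∂P, ∀ᵐ x' ∂P, (x, x') ∈ D →
      ENNReal.ofReal q ≤ Q {y | (x, y) ∈ A ∧ (x', y) ∈ A})
    (hp : ∀ᵐ y ∂Q, ENNReal.ofReal p ≤ P {x | (x, y) ∈ A}) :
    ∫ z, (u z.1 + v z.2) ^ 2 ∂(P.prod Q) ≤
      8 * K / (p * q) * ∫ z in A, (u z.1 + v z.2) ^ 2 ∂(P.prod Q) := by
  have hw2 := (memLp_oplus hu2 hv2).integrable_sq
  set E := ∫ z in A, (u z.1 + v z.2) ^ 2 ∂(P.prod Q) with hE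
  have hE0 : 0 ≤ E := integral_nonneg fun z => sq_nonneg _
  have hFm : Measurable (A.indicator fun z : X × Y => ENNReal.ofReal ((u z.1 + v z.2) ^ 2)) :=
    Measurable.indicator (by fun_prop) hA
  have hEl : ENNReal.ofReal E = ∫⁻ z, A.indicator
      (fun z : X × Y => ENNReal.ofReal ((u z.1 + v z.2) ^ 2)) z ∂(P.prod Q) := by
    rw [lintegral_indicator hA, hE, ofReal_integral_eq_lintegral_ofReal hw2.integrableOn
      (ae_of_all _ fun z => sq_nonneg _)]
  have hul : ENNReal.ofReal (∫ x, u x ^ 2 ∂P) = ∫⁻ x, ENNReal.ofReal (u x ^ 2) ∂P :=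
    ofReal_integral_eq_lintegral_ofReal hu2.integrable_sq (ae_of_all _ fun z => sq_nonneg _)
  have hvl : ENNReal.ofReal (∫ y, v y ^ 2 ∂Q) = ∫⁻ y, ENNReal.ofReal (v y ^ 2) ∂Q :=
    ofReal_integral_eq_lintegral_ofReal hv2.integrable_sq (ae_of_all _ fun z => sq_nonneg _)
  have hvar : ENNReal.ofReal (2 * ∫ x, u x ^ 2 ∂P) =
      ∫⁻ x, ∫⁻ x', ENNReal.ofReal ((u x - u x') ^ 2) ∂P ∂P := by
    have h1 := integral_sq_add_prod (P := P) (Q := P) hu2 hu2.neg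
    have h2 := (memLp_oplus (P := P) (Q := P) hu2 hu2.neg).integrable_sq
    simp only [Pi.neg_apply, neg_sq, integral_neg, hmean, neg_zero, mul_zero, add_zero,
      ← sub_eq_add_neg] at h1 h2
    rw [two_mul, ← h1, ofReal_integral_eq_lintegral_ofReal h2 (ae_of_all _ fun z => sq_nonneg _)]
    exact lintegral_prod _ (by fun_prop)
  have hEu0 : 0 ≤ ∫ x, u x ^ 2 ∂P := integral_nonneg fun x => sq_nonneg _
  have hEv0 : 0 ≤ ∫ y, v y ^ 2 ∂Q := integral_nonneg fun x => sq_nonneg _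
  have hU : q * (2 * ∫ x, u x ^ 2 ∂P) ≤ K * (4 * E) := by
    refine (ENNReal.ofReal_le_ofReal_iff (by positivity)).1 ?_
    rw [ENNReal.ofReal_mul hq0.le, hvar, ENNReal.ofReal_mul (zero_le_one.trans hK),
      ENNReal.ofReal_mul (by norm_num), hEl, lintegral_prod _ hFm.aemeasurable]
    calc _ ≤ ENNReal.ofReal q * (ENNReal.ofReal K * ∫⁻ x, ∫⁻ x', D.indicator
          (fun z => ENNReal.ofReal ((u z.1 - u z.2) ^ 2)) (x, x') ∂P ∂P) := by gcongr
      _ = ENNReal.ofReal K * (ENNReal.ofReal q * ∫⁻ x, ∫⁻ x', D.indicator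
          (fun z => ENNReal.ofReal ((u z.1 - u z.2) ^ 2)) (x, x') ∂P ∂P) := by ring
      _ ≤ _ := by
          refine mul_le_mul_right ?_ _
          have := mul_lintegral_sq_sub_le P Q hu hv hA ENNReal.ofReal_ne_top hq
          simpa using this
  have hV : p * ∫ y, v y ^ 2 ∂Q ≤ 2 * E + 2 * ∫ x, u x ^ 2 ∂P := by
    refine (ENNReal.ofReal_le_ofReal_iff (by positivity)).1 ?_
    rw [ENNReal.ofReal_mul hp0.le, ENNReal.ofReal_add (by positivity) (by positivity),
      ENNReal.ofReal_mul two_pos.le, ENNReal.ofReal_mul two_pos.le, hul, hvl, hEl,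
      lintegral_prod_symm _ hFm.aemeasurable]
    simpa using mul_lintegral_sq_le P Q hu hv hA ENNReal.ofReal_ne_top hp
  rw [integral_sq_add_prod hu2 hv2, hmean, zero_mul, mul_zero, add_zero, div_mul_eq_mul_div,
    le_div_iff₀ (by positivity)]
  set U := ∫ x, u x ^ 2 ∂P
  set V := ∫ y, v y ^ 2 ∂Q
  -- `p q (U + V) ≤ 3 q U + 2 q E ≤ 6 K E + 2 K E`
  have h1 : q * (p * V) ≤ q * (2 * E + 2 * U) := by gcongr
  have h2 : p * (q * U) ≤ 1 * (q * U) := by gcongr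
  have h3 : q * E ≤ K * E := by gcongr; linarith
  nlinarith

/-- A direct sum is controlled in `L²(P ⊗ Q)` by its restriction to `A`, as soon as `A` has enough
sections in common and `u` satisfies a nonlocal Poincaré inequality. Subtracting a constant from
`u` and adding it to `v` reduces to the case where `u` has mean zero. -/
theorem integral_sq_oplus_le (hu : Measurable u) (hv : Measurable v)
    (hu2 : MemLp u 2 P) (hv2 : MemLp v 2 Q) (hA : MeasurableSet A)
    {D : Set (X × X)} {p q K : ℝ} (hp0 : 0 < p) (hp1 : p ≤ 1) (hq0 : 0 < q) (hq1 : q ≤ 1)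
    (hK : 1 ≤ K)
    (hpoinc : ∫⁻ x, ∫⁻ x', ENNReal.ofReal ((u x - u x') ^ 2) ∂P ∂P ≤ ENNReal.ofReal K *
      ∫⁻ x, ∫⁻ x', D.indicator (fun z => ENNReal.ofReal ((u z.1 - u z.2) ^ 2)) (x, x') ∂P ∂P)
    (hq : ∀ᵐ x ∂P, ∀ᵐ x' ∂P, (x, x') ∈ D →
      ENNReal.ofReal q ≤ Q {y | (x, y) ∈ A ∧ (x', y) ∈ A})
    (hp : ∀ᵐ y ∂Q, ENNReal.ofReal p ≤ P {x | (x, y) ∈ A}) :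
    ∫ z, (u z.1 + v z.2) ^ 2 ∂(P.prod Q) ≤
      8 * K / (p * q) * ∫ z in A, (u z.1 + v z.2) ^ 2 ∂(P.prod Q) := by
  set m := ∫ x, u x ∂P with hm
  have h := integral_sq_le_of_integral_eq_zero P Q (u := fun x => u x - m) (v := fun y => v y + m)
    (by fun_prop) (by fun_prop) (hu2.sub (memLp_const m)) (hv2.add (memLp_const m))
    (by rw [integral_sub (hu2.integrable one_le_two) (integrable_const m)]; simp [hm]) hA
    hp0 hp1 hq0 hq1 hK (D := D) (by simpa only [sub_sub_sub_cancel_right] using hpoinc) hq hp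
  have h1 : ∀ z : X × Y, u z.1 - m + (v z.2 + m) = u z.1 + v z.2 := fun z => by ring
  simpa only [h1] using h

end Coercivity

/-! ### First-order calculus of the reduced dual objective -/

section Calculus

/-- The function `s ↦ (s₊)²` lies between its tangent at `a` and the parabola osculating it. -/
theorem sq_posPart_expansion (a t : ℝ) :
    0 ≤ (max (a + t) 0) ^ 2 - (max a 0) ^ 2 - 2 * (max a 0 * t) ∧
      (max (a + t) 0) ^ 2 - (max a 0) ^ 2 - 2 * (max a 0 * t) ≤ t ^ 2 := by
  rcases le_total a 0 with ha | ha <;> rcases le_total (a + t) 0 with hat | hat <;>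
    simp only [max_eq_left, max_eq_right, ha, hat] <;> constructor <;>
    nlinarith [sq_nonneg t, sq_nonneg a, sq_nonneg (a + t)]

variable {X Y : Type*}

/-- The density `(w - c)₊ / ε` that a potential `w` on the product space induces with respect to
`P ⊗ Q`; for the optimal `w` it is the density of the optimal coupling. -/
noncomputable def dens (c : X → Y → ℝ) (ε : ℝ) (w : X × Y → ℝ) (z : X × Y) : ℝ :=
  1 / ε * max (w z - c z.1 z.2) 0

theorem dens_nonneg {c : X → Y → ℝ} {ε : ℝ} (hε : 0 < ε) (w : X × Y → ℝ) (z : X × Y) :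
    0 ≤ dens c ε w z := by
  unfold dens
  positivity

variable [MeasurableSpace X] [MeasurableSpace Y]

theorem memLp_dens {μ : Measure (X × Y)} {c : X → Y → ℝ} (ε : ℝ) {w : X × Y → ℝ} {p : ℝ≥0∞}
    (hc : MemLp (fun z : X × Y => c z.1 z.2) p μ) (hw : MemLp w p μ) :
    MemLp (dens c ε w) p μ :=
  (hw.sub hc).pos_part.const_mul (1 / ε)

theorem norm_sq_eq_integral {Z : Type*} [MeasurableSpace Z] {μ : Measure Z} (f : Lp ℝ 2 μ) :
    ‖f‖ ^ 2 = ∫ z, f z ^ 2 ∂μ := by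
  rw [← real_inner_self_eq_norm_sq, L2.inner_def]
  simp [sq]

variable {P : Measure X} {Q : Measure Y} [IsProbabilityMeasure P] [IsProbabilityMeasure Q]
  {c : X → Y → ℝ} {ε : ℝ}

theorem memLp_one_sub_dens (hc : MemLp (fun z : X × Y => c z.1 z.2) 2 (P.prod Q))
    (w : Lp ℝ 2 (P.prod Q)) : MemLp (fun z => 1 - dens c ε w z) 2 (P.prod Q) :=
  (memLp_const 1).sub (memLp_dens ε hc (Lp.memLp w))

theorem integrable_Phi (hc : MemLp (fun z : X × Y => c z.1 z.2) 2 (P.prod Q))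
    (w : Lp ℝ 2 (P.prod Q)) :
    Integrable (fun z => w z - 1 / (2 * ε) * (max (w z - c z.1 z.2) 0) ^ 2) (P.prod Q) :=
  ((Lp.memLp w).integrable one_le_two).sub
    (((Lp.memLp w).sub hc).pos_part.integrable_sq.const_mul _)

/-- Second-order expansion of `Φ`: the remainder after the linear term is an integral of
`sq_posPart_expansion`. -/
theorem Phi_add_sub (hε : 0 < ε) (hc : MemLp (fun z : X × Y => c z.1 z.2) 2 (P.prod Q))
    (w h : H P Q) :
    Phi P Q c ε (w + h) - Phi P Q c ε w -
        ∫ z, (1 - dens c ε (w : Lp ℝ 2 (P.prod Q)) z) * (h : Lp ℝ 2 (P.prod Q)) z ∂(P.prod Q) ≤ 0 ∧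
      |Phi P Q c ε (w + h) - Phi P Q c ε w -
        ∫ z, (1 - dens c ε (w : Lp ℝ 2 (P.prod Q)) z) * (h : Lp ℝ 2 (P.prod Q)) z ∂(P.prod Q)| ≤
      1 / (2 * ε) * ‖h‖ ^ 2 := by
  have hI : Integrable (fun z => (1 - dens c ε (w : Lp ℝ 2 (P.prod Q)) z) *
      (h : Lp ℝ 2 (P.prod Q)) z) (P.prod Q) :=
    (memLp_one_sub_dens (ε := ε) hc (w : Lp ℝ 2 (P.prod Q))).integrable_mul
      (Lp.memLp (h : Lp ℝ 2 (P.prod Q)))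
  have h1 := integrable_Phi (ε := ε) hc ((w + h : H P Q) : Lp ℝ 2 (P.prod Q))
  have h2 := integrable_Phi (ε := ε) hc (w : Lp ℝ 2 (P.prod Q))
  set R : X × Y → ℝ := fun z =>
    (max ((w : Lp ℝ 2 (P.prod Q)) z - c z.1 z.2 + (h : Lp ℝ 2 (P.prod Q)) z) 0) ^ 2
      - (max ((w : Lp ℝ 2 (P.prod Q)) z - c z.1 z.2) 0) ^ 2
      - 2 * (max ((w : Lp ℝ 2 (P.prod Q)) z - c z.1 z.2) 0 * (h : Lp ℝ 2 (P.prod Q)) z) with hR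
  have hrem : Phi P Q c ε (w + h) - Phi P Q c ε w -
        ∫ z, (1 - dens c ε (w : Lp ℝ 2 (P.prod Q)) z) * (h : Lp ℝ 2 (P.prod Q)) z ∂(P.prod Q) =
      -(1 / (2 * ε) * ∫ z, R z ∂(P.prod Q)) := by
    unfold Phi
    have h12 := h1.sub h2
    simp only [Pi.sub_def] at h12
    rw [← integral_sub h1 h2, ← integral_sub h12 hI, ← integral_const_mul,
      ← integral_neg]
    refine integral_congr_ae ?_
    filter_upwards [Lp.coeFn_add (w : Lp ℝ 2 (P.prod Q)) (h : Lp ℝ 2 (P.prod Q))] with z hz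
    have hz' : ((w + h : H P Q) : Lp ℝ 2 (P.prod Q)) z =
      (w : Lp ℝ 2 (P.prod Q)) z + (h : Lp ℝ 2 (P.prod Q)) z := hz
    simp only [hz', hR, dens]
    rw [add_sub_right_comm _ _ (c z.1 z.2)]
    field_simp
    ring
  have hR0 : 0 ≤ ∫ z, R z ∂(P.prod Q) := integral_nonneg fun z => (sq_posPart_expansion _ _).1
  have hR1 : ∫ z, R z ∂(P.prod Q) ≤ ‖h‖ ^ 2 := by
    rw [Submodule.coe_norm, norm_sq_eq_integral]
    exact integral_mono_of_nonneg (ae_of_all _ fun z => (sq_posPart_expansion _ _).1)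
      (Lp.memLp (h : Lp ℝ 2 (P.prod Q))).integrable_sq
      (ae_of_all _ fun z => (sq_posPart_expansion _ _).2)
  have hε2 : 0 < 1 / (2 * ε) := by positivity
  rw [hrem]
  refine ⟨by nlinarith, ?_⟩
  rw [abs_neg, abs_of_nonneg (by positivity)]
  gcongr

/-- The gradient of `Φ` at `w`: the orthogonal projection to `H` of `1 - (w - c)₊ / ε`. -/
noncomputable def gradPhi (hc : MemLp (fun z : X × Y => c z.1 z.2) 2 (P.prod Q)) (ε : ℝ)
    (w : H P Q) : H P Q :=
  (H P Q).orthogonalProjectionOnto (memLp_one_sub_dens (ε := ε) hc w).toLp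

theorem inner_gradPhi (hc : MemLp (fun z : X × Y => c z.1 z.2) 2 (P.prod Q)) (w h : H P Q) :
    inner ℝ (gradPhi hc ε w) h =
      ∫ z, (1 - dens c ε (w : Lp ℝ 2 (P.prod Q)) z) * (h : Lp ℝ 2 (P.prod Q)) z ∂(P.prod Q) := by
  rw [gradPhi, Submodule.inner_orthogonalProjectionOnto_eq_of_mem_right, L2.inner_def]
  refine integral_congr_ae ?_
  filter_upwards [(memLp_one_sub_dens (ε := ε) hc (w : Lp ℝ 2 (P.prod Q))).coeFn_toLp] with z hz
  rw [hz]
  simp [mul_comm]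

theorem hasGradientAt_Phi (hε : 0 < ε) (hc : MemLp (fun z : X × Y => c z.1 z.2) 2 (P.prod Q))
    (w : H P Q) : HasGradientAt (Phi P Q c ε) (gradPhi hc ε w) w := by
  rw [hasGradientAt_iff_isLittleO_nhds_zero]
  refine Asymptotics.IsBigO.trans_isLittleO (g := fun h : H P Q => ‖h‖ ^ 2) ?_
    (Asymptotics.isLittleO_norm_pow_id one_lt_two)
  refine Asymptotics.IsBigO.of_bound (1 / (2 * ε)) (Filter.Eventually.of_forall fun h => ?_)
  rw [inner_gradPhi, Real.norm_eq_abs, Real.norm_of_nonneg (by positivity)]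
  exact (Phi_add_sub hε hc w h).2

/-- Concavity of `Φ`. -/
theorem Phi_sub_le_inner (hε : 0 < ε) (hc : MemLp (fun z : X × Y => c z.1 z.2) 2 (P.prod Q))
    (w w' : H P Q) : Phi P Q c ε w' - Phi P Q c ε w ≤ inner ℝ (gradPhi hc ε w) (w' - w) := by
  have := (Phi_add_sub hε hc w (w' - w)).1
  rw [add_sub_cancel, ← inner_gradPhi hc] at this
  linarith

theorem IsDualOptimizer.gradPhi_eq_zero (hε : 0 < ε)
    (hc : MemLp (fun z : X × Y => c z.1 z.2) 2 (P.prod Q)) {fs : Lp ℝ 2 P} {gs : Lp ℝ 2 Q}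
    (hopt : IsDualOptimizer P Q c ε fs gs) : gradPhi hc ε (oplus P Q fs gs) = 0 := by
  have hmax : IsLocalMax (Phi P Q c ε) (oplus P Q fs gs) := by
    refine Filter.Eventually.of_forall ?_
    rintro ⟨_, ⟨⟨f, g⟩, rfl⟩⟩
    change Phi P Q c ε (oplus P Q f g) ≤ _
    rw [Phi_oplus, Phi_oplus]
    exact hopt f g
  have := hmax.hasFDerivAt_eq_zero (hasGradientAt_Phi hε hc _).hasFDerivAt
  exact (InnerProductSpace.toDual ℝ (H P Q)).map_eq_zero_iff.1 this

theorem IsDualOptimizer.integral_mul_eq_zero (hε : 0 < ε)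
    (hc : MemLp (fun z : X × Y => c z.1 z.2) 2 (P.prod Q)) {fs : Lp ℝ 2 P} {gs : Lp ℝ 2 Q}
    (hopt : IsDualOptimizer P Q c ε fs gs) (h : H P Q) :
    ∫ z, (1 - dens c ε (oplus P Q fs gs : Lp ℝ 2 (P.prod Q)) z) *
      (h : Lp ℝ 2 (P.prod Q)) z ∂(P.prod Q) = 0 := by
  rw [← inner_gradPhi hc, hopt.gradPhi_eq_zero hε hc, inner_zero_left]

end Calculus

/-! ### Optimality conditions and regularity of the optimal potentials -/

section Optimality

/-- The map `t ↦ ∫ (a + t)₊` is strictly increasing where it is positive. -/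
theorem nonpos_of_integral_posPart_eq {Y : Type*} [MeasurableSpace Y] {ν : Measure Y} {a b : Y → ℝ}
    {t ε : ℝ} (hε : 0 < ε) (ha : ∫ y, max (a y) 0 ∂ν = ε) (hb : ∫ y, max (b y) 0 ∂ν = ε)
    (hab : ∀ y, a y + t ≤ b y) : t ≤ 0 := by
  by_contra! ht
  have hai : Integrable (fun y => max (a y) 0) ν :=
    not_imp_comm.1 integral_undef (by rw [ha]; exact hε.ne')
  have hbi : Integrable (fun y => max (b y) 0) ν :=
    not_imp_comm.1 integral_undef (by rw [hb]; exact hε.ne')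
  have hle : (fun y => max (a y) 0) ≤ᵐ[ν] fun y => max (b y) 0 :=
    ae_of_all _ fun y => max_le_max_right 0 (by linarith [hab y])
  have heq := (integral_eq_iff_of_ae_le hai hbi hle).1 (ha.trans hb.symm)
  have h0 : (fun y => max (a y) 0) =ᵐ[ν] 0 := by
    filter_upwards [heq] with y hy
    rcases le_or_gt (a y) 0 with h | h
    · exact max_eq_right h
    · have := hab y
      rw [max_eq_left h.le, max_eq_left (by linarith)] at hy
      linarith
  rw [integral_congr_ae h0] at ha
  simp at ha
  exact hε.ne ha

/-- Two values of a potential solving the first-order condition differ by at most the oscillation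
of the cost. -/
theorem abs_sub_le_of_integral_posPart_eq {X Y : Type*} [MeasurableSpace Y] {ν : Measure Y}
    {c : X → Y → ℝ} {φ : X → ℝ} {g : Y → ℝ} {ε M : ℝ} (hε : 0 < ε) {x x' : X}
    (hx : ∫ y, max (φ x + g y - c x y) 0 ∂ν = ε) (hx' : ∫ y, max (φ x' + g y - c x' y) 0 ∂ν = ε)
    (hM : ∀ y, |c x y - c x' y| ≤ M) : |φ x - φ x'| ≤ M := by
  rw [abs_le]
  constructor
  · have := nonpos_of_integral_posPart_eq (t := φ x' - φ x - M) hε hx hx' fun y => by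
      linarith [neg_abs_le (c x y - c x' y), hM y]
    linarith
  · have := nonpos_of_integral_posPart_eq (t := φ x - φ x' - M) hε hx' hx fun y => by
      linarith [le_abs_self (c x y - c x' y), hM y]
    linarith

theorem exists_le_of_integral_posPart_eq {Y : Type*} [MeasurableSpace Y] {ν : Measure Y}
    [IsProbabilityMeasure ν] {a : Y → ℝ} {ε : ℝ} (hε : 0 < ε) (ha : ∫ y, max (a y) 0 ∂ν = ε)
    {p : Y → Prop} (hp : ∀ᵐ y ∂ν, p y) : ∃ y, p y ∧ ε ≤ a y := by
  have hai : Integrable (fun y => max (a y) 0) ν :=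
    not_imp_comm.1 integral_undef (by rw [ha]; exact hε.ne')
  obtain ⟨y, hy, hle⟩ := exists_notMem_null_integral_le hai (ae_iff.1 hp)
  refine ⟨y, not_not.1 hy, ?_⟩
  rw [ha] at hle
  exact (le_max_iff.1 hle).resolve_right hε.not_ge

variable {X Y : Type*} [MeasurableSpace X] [MeasurableSpace Y]
  {P : Measure X} {Q : Measure Y} [IsProbabilityMeasure P] [IsProbabilityMeasure Q]
  {c : X → Y → ℝ} {ε : ℝ}

theorem ae_integral_snd_eq_zero {k : X × Y → ℝ} (hk : Integrable k (P.prod Q))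
    (h0 : ∀ S, MeasurableSet S → ∫ z, S.indicator 1 z.1 * k z ∂(P.prod Q) = 0) :
    ∀ᵐ x ∂P, ∫ y, k (x, y) ∂Q = 0 := by
  refine hk.integral_prod_left.ae_eq_zero_of_forall_setIntegral_eq_zero fun S hS _ => ?_
  rw [← h0 S hS, ← integral_indicator hS, integral_prod]
  · refine integral_congr_ae (ae_of_all _ fun x => ?_)
    by_cases hx : x ∈ S <;> simp [hx]
  · refine hk.bdd_mul (c := 1) ?_ (ae_of_all _ fun z => ?_)
    · exact ((measurable_one.indicator hS).comp measurable_fst).aestronglyMeasurable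
    · by_cases hx : z.1 ∈ S <;> simp [hx]

theorem ae_integral_fst_eq_zero {k : X × Y → ℝ} (hk : Integrable k (P.prod Q))
    (h0 : ∀ S, MeasurableSet S → ∫ z, S.indicator 1 z.2 * k z ∂(P.prod Q) = 0) :
    ∀ᵐ y ∂Q, ∫ x, k (x, y) ∂P = 0 := by
  refine ae_integral_snd_eq_zero (k := fun z : Y × X => k z.swap) hk.swap fun S hS => ?_
  rw [← h0 S hS, ← integral_prod_swap]
  rfl

/-- The first-order condition with the representative `fs ⊕ gs` in place of the class in `H`. -/
theorem IsDualOptimizer.integral_mul_oplus_eq_zero (hε : 0 < ε)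
    (hc : MemLp (fun z : X × Y => c z.1 z.2) 2 (P.prod Q)) {fs : Lp ℝ 2 P} {gs : Lp ℝ 2 Q}
    (hopt : IsDualOptimizer P Q c ε fs gs) {u : X → ℝ} {v : Y → ℝ} (hu : MemLp u 2 P)
    (hv : MemLp v 2 Q) :
    ∫ z, (u z.1 + v z.2) * (1 - dens c ε (fun z => fs z.1 + gs z.2) z) ∂(P.prod Q) = 0 := by
  rw [← hopt.integral_mul_eq_zero hε hc (oplus P Q hu.toLp hv.toLp)]
  refine integral_congr_ae ?_
  filter_upwards [coeFn_oplus fs gs, coeFn_oplus (hu.toLp (f := u)) (hv.toLp (f := v)),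
    Measure.quasiMeasurePreserving_fst.ae hu.coeFn_toLp,
    Measure.quasiMeasurePreserving_snd.ae hv.coeFn_toLp] with z h1 h2 h3 h4
  rw [h2, h3, h4, mul_comm]
  simp only [dens, h1]

theorem memLp_dens_oplus (ε : ℝ) (hc : MemLp (fun z : X × Y => c z.1 z.2) 2 (P.prod Q))
    (fs : Lp ℝ 2 P) (gs : Lp ℝ 2 Q) :
    MemLp (dens c ε fun z => fs z.1 + gs z.2) 2 (P.prod Q) :=
  memLp_dens ε hc (memLp_oplus (Lp.memLp fs) (Lp.memLp gs))

theorem IsDualOptimizer.ae_integral_dens_snd (hε : 0 < ε)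
    (hc : MemLp (fun z : X × Y => c z.1 z.2) 2 (P.prod Q)) {fs : Lp ℝ 2 P} {gs : Lp ℝ 2 Q}
    (hopt : IsDualOptimizer P Q c ε fs gs) :
    ∀ᵐ x ∂P, ∫ y, dens c ε (fun z => fs z.1 + gs z.2) (x, y) ∂Q = 1 := by
  have hD := (memLp_dens_oplus ε hc fs gs).integrable one_le_two
  have h := ae_integral_snd_eq_zero ((integrable_const (1 : ℝ)).sub hD) fun S hS => by
    have hi : MemLp (S.indicator (1 : X → ℝ)) 2 P := (memLp_const (1 : ℝ)).indicator hS
    simpa using hopt.integral_mul_oplus_eq_zero hε hc hi (MemLp.zero (p := 2) (μ := Q))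
  filter_upwards [h, hD.prod_right_ae] with x hx hDx
  simp only [Pi.sub_apply] at hx
  rw [integral_sub (integrable_const _) hDx] at hx
  simp at hx
  linarith

theorem IsDualOptimizer.ae_integral_dens_fst (hε : 0 < ε)
    (hc : MemLp (fun z : X × Y => c z.1 z.2) 2 (P.prod Q)) {fs : Lp ℝ 2 P} {gs : Lp ℝ 2 Q}
    (hopt : IsDualOptimizer P Q c ε fs gs) :
    ∀ᵐ y ∂Q, ∫ x, dens c ε (fun z => fs z.1 + gs z.2) (x, y) ∂P = 1 := by
  have hD := (memLp_dens_oplus ε hc fs gs).integrable one_le_two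
  have h := ae_integral_fst_eq_zero ((integrable_const (1 : ℝ)).sub hD) fun S hS => by
    have hi : MemLp (S.indicator (1 : Y → ℝ)) 2 Q := (memLp_const (1 : ℝ)).indicator hS
    simpa using hopt.integral_mul_oplus_eq_zero hε hc (MemLp.zero (p := 2) (μ := P)) hi
  filter_upwards [h, hD.prod_left_ae] with x hx hDx
  simp only [Pi.sub_apply] at hx
  rw [integral_sub (integrable_const _) hDx] at hx
  simp at hx
  linarith

theorem integral_posPart_eq_of_integral_dens_eq_one {Z : Type*} [MeasurableSpace Z]
    {ν : Measure Z} {a : Z → ℝ} (hε : 0 < ε) (h : ∫ z, 1 / ε * max (a z) 0 ∂ν = 1) :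
    ∫ z, max (a z) 0 ∂ν = ε := by
  rw [integral_const_mul] at h
  field_simp at h
  exact h

theorem IsDualOptimizer.ae_integral_posPart_snd (hε : 0 < ε)
    (hc : MemLp (fun z : X × Y => c z.1 z.2) 2 (P.prod Q)) {fs : Lp ℝ 2 P} {gs : Lp ℝ 2 Q}
    (hopt : IsDualOptimizer P Q c ε fs gs) :
    ∀ᵐ x ∂P, ∫ y, max (fs x + gs y - c x y) 0 ∂Q = ε :=
  (hopt.ae_integral_dens_snd hε hc).mono fun _ hx =>
    integral_posPart_eq_of_integral_dens_eq_one hε hx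

theorem IsDualOptimizer.ae_integral_posPart_fst (hε : 0 < ε)
    (hc : MemLp (fun z : X × Y => c z.1 z.2) 2 (P.prod Q)) {fs : Lp ℝ 2 P} {gs : Lp ℝ 2 Q}
    (hopt : IsDualOptimizer P Q c ε fs gs) :
    ∀ᵐ y ∂Q, ∫ x, max (gs y + fs x - c x y) 0 ∂P = ε :=
  (hopt.ae_integral_dens_fst hε hc).mono fun _ hy =>
    integral_posPart_eq_of_integral_dens_eq_one hε (by simpa [dens, add_comm] using hy)

/-- A measurable function that is Lipschitz on a full subset of a bounded set of full measure is
essentially bounded. -/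
theorem memLp_top_of_ae_lipschitz {E : Type*} [NormedAddCommGroup E] [MeasurableSpace E]
    {μ : Measure E} [IsProbabilityMeasure μ] {φ : E → ℝ} (hφ : AEStronglyMeasurable φ μ)
    {K : Set E} (hK : Bornology.IsBounded K) {G : E → Prop} (hG : ∀ᵐ x ∂μ, x ∈ K ∧ G x) {L : ℝ}
    (hL : 0 ≤ L) (hlip : ∀ x x', G x → G x' → |φ x - φ x'| ≤ L * ‖x - x'‖) : MemLp φ ∞ μ := by
  obtain ⟨x₀, hx₀, hGx₀⟩ := hG.exists
  refine memLp_top_of_bound hφ (|φ x₀| + L * Metric.diam K) ?_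
  filter_upwards [hG] with x hx
  have h1 := hlip x x₀ hx.2 hGx₀
  have h2 : ‖x - x₀‖ ≤ Metric.diam K := by
    rw [← dist_eq_norm]
    exact Metric.dist_le_diam_of_mem hK hx.1 hx₀
  rw [Real.norm_eq_abs]
  have h3 : |φ x| ≤ |φ x - φ x₀| + |φ x₀| := by
    simpa using abs_add_le (φ x - φ x₀) (φ x₀)
  have h4 := mul_le_mul_of_nonneg_left h2 hL
  linarith

end Optimality

/-! ### The optimal coupling and the primal value -/

section Coupling

variable {X Y : Type*} [MeasurableSpace X] [MeasurableSpace Y]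
  {P : Measure X} {Q : Measure Y} [IsProbabilityMeasure P] [IsProbabilityMeasure Q]
  {c : X → Y → ℝ} {ε : ℝ}

theorem lintegral_ofReal_eq_one {Z : Type*} [MeasurableSpace Z] {ν : Measure Z} {a : Z → ℝ}
    (ha : ∀ z, 0 ≤ a z) (h : ∫ z, a z ∂ν = 1) : ∫⁻ z, ENNReal.ofReal (a z) ∂ν = 1 := by
  have hi : Integrable a ν := not_imp_comm.1 integral_undef (by rw [h]; exact one_ne_zero)
  rw [← ofReal_integral_eq_lintegral_ofReal hi (ae_of_all _ ha), h, ENNReal.ofReal_one]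

theorem withDensity_mem_couplings {D : X × Y → ℝ} (hD : Measurable D) (hD0 : ∀ z, 0 ≤ D z)
    (h1 : ∀ᵐ x ∂P, ∫ y, D (x, y) ∂Q = 1) (h2 : ∀ᵐ y ∂Q, ∫ x, D (x, y) ∂P = 1) :
    (P.prod Q).withDensity (fun z => ENNReal.ofReal (D z)) ∈ couplings P Q := by
  have hDm : Measurable fun z => ENNReal.ofReal (D z) := hD.ennreal_ofReal
  constructor
  · ext S hS
    rw [Measure.map_apply measurable_fst hS, withDensity_apply _ (measurable_fst hS),
      ← Set.prod_univ, ← Measure.prod_restrict, Measure.restrict_univ,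
      lintegral_prod _ hDm.aemeasurable, ← setLIntegral_one]
    refine lintegral_congr_ae (ae_restrict_of_ae ?_)
    filter_upwards [h1] with x hx
    exact lintegral_ofReal_eq_one (fun y => hD0 (x, y)) hx
  · ext S hS
    rw [Measure.map_apply measurable_snd hS, withDensity_apply _ (measurable_snd hS),
      ← Set.univ_prod, ← Measure.prod_restrict, Measure.restrict_univ,
      lintegral_prod_symm _ hDm.aemeasurable, ← setLIntegral_one]
    refine lintegral_congr_ae (ae_restrict_of_ae ?_)
    filter_upwards [h2] with y hy
    exact lintegral_ofReal_eq_one (fun x => hD0 (x, y)) hy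

/-- One half of strong duality: `(fs ⊕ gs - c)₊ / ε` is the density of a coupling, whose cost
is the optimal dual value. -/
theorem IsDualOptimizer.QOT_le (hε : 0 < ε) (hcm : Measurable fun z : X × Y => c z.1 z.2)
    (hc : MemLp (fun z : X × Y => c z.1 z.2) 2 (P.prod Q)) {fs : Lp ℝ 2 P} {gs : Lp ℝ 2 Q}
    (hopt : IsDualOptimizer P Q c ε fs gs) :
    QOT P Q c ε ≤ (Phi P Q c ε (oplus P Q fs gs) : EReal) := by
  set W : X × Y → ℝ := fun z => fs z.1 + gs z.2 with hW
  set D : X × Y → ℝ := dens c ε W with hDdef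
  have hfm := (Lp.stronglyMeasurable fs).measurable
  have hgm := (Lp.stronglyMeasurable gs).measurable
  have hWm : Measurable W := (hfm.comp measurable_fst).add (hgm.comp measurable_snd)
  have hDm : Measurable D := ((hWm.sub hcm).max measurable_const).const_mul _
  have hD0 : ∀ z, 0 ≤ D z := dens_nonneg hε W
  have hD2 : MemLp D 2 (P.prod Q) := memLp_dens_oplus ε hc fs gs
  set π := (P.prod Q).withDensity fun z => ENNReal.ofReal (D z) with hπ
  have hmem : π ∈ couplings P Q := withDensity_mem_couplings hDm hD0
    (hopt.ae_integral_dens_snd hε hc) (hopt.ae_integral_dens_fst hε hc)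
  have hcost : ∫ z, c z.1 z.2 ∂π = ∫ z, D z * c z.1 z.2 ∂(P.prod Q) := by
    rw [hπ, integral_withDensity_eq_integral_toReal_smul hDm.ennreal_ofReal
      (ae_of_all _ fun z => ENNReal.ofReal_lt_top)]
    simp only [ENNReal.toReal_ofReal (hD0 _), smul_eq_mul]
  have hnorm : sqDensityNorm P Q π = ENNReal.ofReal (∫ z, D z ^ 2 ∂(P.prod Q)) := by
    rw [sqDensityNorm, if_pos (withDensity_absolutelyContinuous _ _),
      ofReal_integral_eq_lintegral_ofReal hD2.integrable_sq (ae_of_all _ fun z => sq_nonneg _)]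
    refine lintegral_congr_ae ?_
    filter_upwards [Measure.rnDeriv_withDensity (P.prod Q) hDm.ennreal_ofReal] with z hz
    rw [hz, ENNReal.ofReal_pow (hD0 z)]
  have hWi : Integrable (fun z => W z * (1 - D z)) (P.prod Q) :=
    (memLp_oplus (Lp.memLp fs) (Lp.memLp gs)).integrable_mul ((memLp_const (1 : ℝ)).sub hD2)
  have hDc : Integrable (fun z => D z * c z.1 z.2) (P.prod Q) := hD2.integrable_mul hc
  have hDD : Integrable (fun z => ε / 2 * D z ^ 2) (P.prod Q) := hD2.integrable_sq.const_mul _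
  have hval : Phi P Q c ε (oplus P Q fs gs) =
      ∫ z, D z * c z.1 z.2 ∂(P.prod Q) + ε / 2 * ∫ z, D z ^ 2 ∂(P.prod Q) := by
    have h0 : ∫ z, W z * (1 - D z) ∂(P.prod Q) = 0 :=
      hopt.integral_mul_oplus_eq_zero hε hc (Lp.memLp fs) (Lp.memLp gs)
    have hDs : Integrable (fun z => D z * c z.1 z.2 + ε / 2 * D z ^ 2) (P.prod Q) := hDc.add hDD
    have h1 := integral_add hWi hDs
    rw [h0, zero_add] at h1
    rw [Phi_oplus, Gam, ← integral_const_mul, ← integral_add hDc hDD, ← h1]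
    refine integral_congr_ae (ae_of_all _ fun z => ?_)
    -- `D (W - c) = ε D ^ 2`, since `s * s₊ = (s₊) ^ 2`
    have hmax : max (W z - c z.1 z.2) 0 * (W z - c z.1 z.2) = max (W z - c z.1 z.2) 0 ^ 2 := by
      rcases le_total (W z - c z.1 z.2) 0 with h | h
      · simp [max_eq_right h]
      · rw [max_eq_left h, sq]
    change W z - 1 / (2 * ε) * max (W z - c z.1 z.2) 0 ^ 2 =
      W z * (1 - 1 / ε * max (W z - c z.1 z.2) 0) + (1 / ε * max (W z - c z.1 z.2) 0 * c z.1 z.2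
        + ε / 2 * (1 / ε * max (W z - c z.1 z.2) 0) ^ 2)
    set m := max (W z - c z.1 z.2) 0
    field_simp
    linear_combination (2 : ℝ) * hmax
  refine (iInf₂_le π hmem).trans (le_of_eq ?_)
  rw [hcost, hnorm, hval, ← ENNReal.ofReal_mul (by positivity),
    EReal.coe_ennreal_ofReal, max_eq_left, ← EReal.coe_add]
  exact mul_nonneg (by positivity) (integral_nonneg fun z => sq_nonneg _)

end Coupling

/-! ### Strong monotonicity of the gradient where the optimal slack is large -/

section StrongMonotonicity

/-- For a slack `s ≥ ε / 2` and a perturbation `|t| ≤ m`, the monotone map `s ↦ s₊` grows from `s`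
to `s + t` at least at the rate `ε / (2 m)`: either `s + t ≥ 0` and the rate is one, or the map has
already dropped by `s ≥ ε / 2`. -/
theorem posPart_strong_mono {ε m s t : ℝ} (hε : 0 < ε) (hm : ε ≤ m) (hs : ε / 2 ≤ s)
    (ht : |t| ≤ m) : 1 / (2 * m) * t ^ 2 ≤ 1 / ε * ((max (s + t) 0 - max s 0) * t) := by
  have hm0 : 0 < m := hε.trans_le hm
  have hs0 : 0 ≤ s := by linarith
  rw [max_eq_left hs0, one_div_mul_eq_div, one_div_mul_eq_div,
    div_le_div_iff₀ (by positivity) hε]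
  rcases le_total 0 (s + t) with h | h
  · rw [max_eq_left h]
    nlinarith [sq_nonneg t]
  · rw [max_eq_right h]
    have ht0 : t ≤ 0 := by linarith
    rw [abs_of_nonpos ht0] at ht
    -- `ε t² ≤ ε m |t| ≤ 2 s m |t|`
    have h1 : ε * (-t) * (-t) ≤ ε * (-t) * m :=
      mul_le_mul_of_nonneg_left ht (mul_nonneg hε.le (by linarith))
    have h2 : ε * ((-t) * m) ≤ 2 * s * ((-t) * m) :=
      mul_le_mul_of_nonneg_right (by linarith) (mul_nonneg (by linarith) hm0.le)
    nlinarith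

theorem posPart_mono_mul_nonneg {ε : ℝ} (hε : 0 < ε) (s t : ℝ) :
    0 ≤ 1 / ε * ((max (s + t) 0 - max s 0) * t) := by
  refine mul_nonneg (by positivity) ?_
  rcases le_total 0 t with ht | ht
  · exact mul_nonneg (sub_nonneg.2 (max_le_max_right 0 (by linarith))) ht
  · exact mul_nonneg_of_nonpos_of_nonpos (sub_nonpos.2 (max_le_max_right 0 (by linarith))) ht

variable {X Y : Type*} [MeasurableSpace X] [MeasurableSpace Y]
  {P : Measure X} {Q : Measure Y} [IsProbabilityMeasure P] [IsProbabilityMeasure Q]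
  {c : X → Y → ℝ} {ε : ℝ}

theorem coeFn_oplus_sub_oplus (f fs : Lp ℝ 2 P) (g gs : Lp ℝ 2 Q) :
    ((oplus P Q f g - oplus P Q fs gs : H P Q) : Lp ℝ 2 (P.prod Q)) =ᵐ[P.prod Q]
      fun z => (f z.1 - fs z.1) + (g z.2 - gs z.2) := by
  filter_upwards [Lp.coeFn_sub (oplus P Q f g : Lp ℝ 2 (P.prod Q)) (oplus P Q fs gs),
    coeFn_oplus f g, coeFn_oplus fs gs] with z h1 h2 h3
  change ((oplus P Q f g : Lp ℝ 2 (P.prod Q)) - oplus P Q fs gs : Lp ℝ 2 (P.prod Q)) z = _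
  rw [h1, Pi.sub_apply, h2, h3]
  ring

theorem measurableSet_le_slack {μ : Measure X} {ν : Measure Y}
    (hcm : Measurable fun z : X × Y => c z.1 z.2) (fs : Lp ℝ 2 μ) (gs : Lp ℝ 2 ν) (a : ℝ) :
    MeasurableSet {z : X × Y | a ≤ fs z.1 + gs z.2 - c z.1 z.2} :=
  measurableSet_le measurable_const
    ((((Lp.stronglyMeasurable fs).measurable.comp measurable_fst).add
      ((Lp.stronglyMeasurable gs).measurable.comp measurable_snd)).sub hcm)

/-- The gradient at `f ⊕ g` controls the error `f ⊕ g - fs ⊕ gs` in `L²` of the set where the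
optimal slack `fs ⊕ gs - c` is at least `ε / 2`. -/
theorem IsDualOptimizer.setIntegral_sq_le_inner (hε : 0 < ε)
    (hcm : Measurable fun z : X × Y => c z.1 z.2)
    (hc : MemLp (fun z : X × Y => c z.1 z.2) 2 (P.prod Q)) {fs : Lp ℝ 2 P} {gs : Lp ℝ 2 Q}
    (hopt : IsDualOptimizer P Q c ε fs gs) (f : Lp ℝ 2 P) (g : Lp ℝ 2 Q) {m : ℝ} (hm : ε ≤ m)
    (hbd : ∀ᵐ z ∂(P.prod Q), |(f z.1 - fs z.1) + (g z.2 - gs z.2)| ≤ m) :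
    1 / (2 * m) * ∫ z in {z : X × Y | ε / 2 ≤ fs z.1 + gs z.2 - c z.1 z.2},
        ((f z.1 - fs z.1) + (g z.2 - gs z.2)) ^ 2 ∂(P.prod Q) ≤
      inner ℝ (gradPhi hc ε (oplus P Q f g)) (oplus P Q fs gs - oplus P Q f g) := by
  set w := oplus P Q f g
  set ws := oplus P Q fs gs
  set A := {z : X × Y | ε / 2 ≤ fs z.1 + gs z.2 - c z.1 z.2} with hA
  have hAm : MeasurableSet A := measurableSet_le_slack hcm fs gs (ε / 2)
  set h : H P Q := ws - w with hh
  have hI : ∀ w' : H P Q, Integrable (fun z => (1 - dens c ε (w' : Lp ℝ 2 (P.prod Q)) z) *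
      (h : Lp ℝ 2 (P.prod Q)) z) (P.prod Q) := fun w' =>
    (memLp_one_sub_dens (ε := ε) hc (w' : Lp ℝ 2 (P.prod Q))).integrable_mul
      (Lp.memLp (h : Lp ℝ 2 (P.prod Q)))
  have hsub : inner ℝ (gradPhi hc ε w) h = ∫ z, ((1 - dens c ε (w : Lp ℝ 2 (P.prod Q)) z) *
      (h : Lp ℝ 2 (P.prod Q)) z - (1 - dens c ε (ws : Lp ℝ 2 (P.prod Q)) z) *
      (h : Lp ℝ 2 (P.prod Q)) z) ∂(P.prod Q) := by
    rw [integral_sub (hI w) (hI ws), ← inner_gradPhi hc, ← inner_gradPhi hc,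
      hopt.gradPhi_eq_zero hε hc, inner_zero_left, sub_zero]
  have hsq : Integrable (fun z : X × Y => ((f z.1 - fs z.1) + (g z.2 - gs z.2)) ^ 2)
      (P.prod Q) :=
    (memLp_oplus ((Lp.memLp f).sub (Lp.memLp fs)) ((Lp.memLp g).sub (Lp.memLp gs))).integrable_sq
  rw [hsub, ← integral_const_mul, ← integral_indicator hAm]
  refine integral_mono_ae ((hsq.const_mul _).indicator hAm) ((hI w).sub (hI ws)) ?_
  filter_upwards [hbd, coeFn_oplus f g, coeFn_oplus fs gs, coeFn_oplus_sub_oplus fs f gs g]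
    with z hz h1 h2 h3
  set t := (f z.1 - fs z.1) + (g z.2 - gs z.2) with ht
  set s := fs z.1 + gs z.2 - c z.1 z.2 with hs
  have hR : (1 - dens c ε (w : Lp ℝ 2 (P.prod Q)) z) * (h : Lp ℝ 2 (P.prod Q)) z -
      (1 - dens c ε (ws : Lp ℝ 2 (P.prod Q)) z) * (h : Lp ℝ 2 (P.prod Q)) z =
      1 / ε * ((max (s + t) 0 - max s 0) * t) := by
    have e1 : f z.1 + g z.2 - c z.1 z.2 = s + t := by rw [hs, ht]; ring
    have e2 : (h : Lp ℝ 2 (P.prod Q)) z = -t := by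
      rw [h3, ht]
      ring
    rw [e2]
    simp only [dens, h1, h2, e1, w, ws]
    ring
  rw [hR]
  by_cases hzA : z ∈ A
  · rw [Set.indicator_of_mem hzA]
    exact posPart_strong_mono hε hm hzA hz
  · rw [Set.indicator_of_notMem hzA]
    exact posPart_mono_mul_nonneg hε s t

end StrongMonotonicity

/-! ### Coercivity for the optimal slack on `ℝ^d` -/

section Euclidean

/-- The balls of a fixed radius centred at the points of a compact support have uniformly positive
mass. -/
theorem exists_pos_le_measureReal_ball {E : Type*} [NormedAddCommGroup E] [MeasurableSpace E]
    {Q : Measure E} [IsFiniteMeasure Q] (hQ : IsCompact Q.support) {r : ℝ} (hr : 0 < r) :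
    ∃ q : ℝ, 0 < q ∧ ∀ y ∈ Q.support, q ≤ Q.real (Metric.ball y r) := by
  rcases Q.support.eq_empty_or_nonempty with h0 | hne
  · exact ⟨1, one_pos, by simp [h0]⟩
  obtain ⟨t, hts, htf, hcov⟩ := hQ.finite_cover_balls (half_pos hr)
  have htne : t.Nonempty := by
    obtain ⟨y, hy⟩ := hne
    obtain ⟨i, hi, -⟩ := Set.mem_iUnion₂.1 (hcov hy)
    exact ⟨i, hi⟩
  obtain ⟨y₀, hy₀, hmin⟩ := Set.exists_min_image t (fun y => Q.real (Metric.ball y (r / 2)))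
    htf htne
  refine ⟨Q.real (Metric.ball y₀ (r / 2)), ?_, fun y hy => ?_⟩
  · exact ENNReal.toReal_pos ((Measure.mem_support_iff_forall y₀).1 (hts hy₀) _
      (Metric.ball_mem_nhds y₀ (half_pos hr))).ne' (measure_ne_top _ _)
  · obtain ⟨i, hi, hyi⟩ := Set.mem_iUnion₂.1 (hcov hy)
    refine (hmin i hi).trans (measureReal_mono ?_)
    refine Metric.ball_subset_ball' ?_
    rw [Metric.mem_ball, dist_comm] at hyi
    linarith

variable {d : ℕ} {P Q : Measure (EuclideanSpace ℝ (Fin d))}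
  {c : EuclideanSpace ℝ (Fin d) → EuclideanSpace ℝ (Fin d) → ℝ} {L ε : ℝ}

theorem measurable_cost (hL : 0 < L)
    (hc : ∀ x x' y y', |c x y - c x' y'| ≤ L * (‖x - x'‖ + ‖y - y'‖)) :
    Measurable fun z : EuclideanSpace ℝ (Fin d) × EuclideanSpace ℝ (Fin d) => c z.1 z.2 := by
  refine (LipschitzWith.of_dist_le_mul (K := ⟨2 * L, by positivity⟩) fun z z' => ?_).continuous
    |>.measurable
  rw [Real.dist_eq]
  refine (hc _ _ _ _).trans ?_
  rw [← dist_eq_norm, ← dist_eq_norm, Prod.dist_eq]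
  change _ ≤ 2 * L * _
  have h1 := le_max_left (dist z.1 z'.1) (dist z.2 z'.2)
  have h2 := le_max_right (dist z.1 z'.1) (dist z.2 z'.2)
  nlinarith

theorem memLp_cost [IsProbabilityMeasure P] [IsProbabilityMeasure Q]
    (hP : IsCompact P.support) (hQ : IsCompact Q.support) (hL : 0 < L)
    (hc : ∀ x x' y y', |c x y - c x' y'| ≤ L * (‖x - x'‖ + ‖y - y'‖)) :
    MemLp (fun z : EuclideanSpace ℝ (Fin d) × EuclideanSpace ℝ (Fin d) => c z.1 z.2) 2
      (P.prod Q) := by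
  obtain ⟨x₀, hx₀⟩ := Measure.nonempty_support (IsProbabilityMeasure.ne_zero P)
  obtain ⟨y₀, hy₀⟩ := Measure.nonempty_support (IsProbabilityMeasure.ne_zero Q)
  refine MemLp.of_bound (measurable_cost hL hc).aestronglyMeasurable
    (L * (Metric.diam P.support + Metric.diam Q.support) + |c x₀ y₀|) ?_
  filter_upwards [Measure.quasiMeasurePreserving_fst.ae (Measure.support_mem_ae (μ := P)),
    Measure.quasiMeasurePreserving_snd.ae (Measure.support_mem_ae (μ := Q))] with z hz1 hz2
  have h1 := hc z.1 x₀ z.2 y₀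
  rw [← dist_eq_norm, ← dist_eq_norm] at h1
  have h2 : L * (dist z.1 x₀ + dist z.2 y₀) ≤
      L * (Metric.diam P.support + Metric.diam Q.support) := by
    gcongr
    · exact Metric.dist_le_diam_of_mem hP.isBounded hz1 hx₀
    · exact Metric.dist_le_diam_of_mem hQ.isBounded hz2 hy₀
  have h3 := abs_add_le (c z.1 z.2 - c x₀ y₀) (c x₀ y₀)
  rw [sub_add_cancel] at h3
  rw [Real.norm_eq_abs]
  linarith

/-- A point `x` of the support of `P` at which the potential `φ` satisfies the first-order condition
`∫ (φ x + ψ y - c x y)₊ dQ(y) = ε`. The potential on the side of `Q` is treated by exchanging `P`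
and `Q`, `φ` and `ψ`, and the arguments of `c`. -/
def IsRegularPoint (P Q : Measure (EuclideanSpace ℝ (Fin d)))
    (c : EuclideanSpace ℝ (Fin d) → EuclideanSpace ℝ (Fin d) → ℝ) (ε : ℝ)
    (φ ψ : EuclideanSpace ℝ (Fin d) → ℝ) (x : EuclideanSpace ℝ (Fin d)) : Prop :=
  x ∈ P.support ∧ ∫ y, max (φ x + ψ y - c x y) 0 ∂Q = ε

theorem IsRegularPoint.abs_sub_le {φ ψ : EuclideanSpace ℝ (Fin d) → ℝ} (hε : 0 < ε)
    (hc : ∀ x x' y, |c x y - c x' y| ≤ L * ‖x - x'‖) {x x' : EuclideanSpace ℝ (Fin d)}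
    (hx : IsRegularPoint P Q c ε φ ψ x) (hx' : IsRegularPoint P Q c ε φ ψ x') :
    |φ x - φ x'| ≤ L * ‖x - x'‖ :=
  abs_sub_le_of_integral_posPart_eq hε hx.2 hx'.2 (hc x x')

/-- The slack `fs ⊕ gs - c` is `2 L`-Lipschitz on regular points, so a slack of `ε` persists as a
slack of `ε / 2` within distance `ε / (8 L)` in each variable. -/
theorem half_le_slack {fs : Lp ℝ 2 P} {gs : Lp ℝ 2 Q} {x x' y y' : EuclideanSpace ℝ (Fin d)}
    (hε : 0 < ε) (hL : 0 < L)
    (hc : ∀ x x' y y', |c x y - c x' y'| ≤ L * (‖x - x'‖ + ‖y - y'‖))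
    (hx : IsRegularPoint P Q c ε fs gs x) (hx' : IsRegularPoint P Q c ε fs gs x')
    (hy : IsRegularPoint Q P (fun y x => c x y) ε gs fs y)
    (hy' : IsRegularPoint Q P (fun y x => c x y) ε gs fs y')
    (hslack : ε ≤ fs x + gs y - c x y) (hxx' : dist x x' ≤ ε / (8 * L))
    (hyy' : dist y y' ≤ ε / (8 * L)) : ε / 2 ≤ fs x' + gs y' - c x' y' := by
  have h1 := hx.abs_sub_le (L := L) hε (fun x x' y => by simpa using hc x x' y y) hx'
  have h2 := hy.abs_sub_le (L := L) hε (fun y y' x => by simpa using hc x x y y') hy'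
  have h3 := hc x x' y y'
  rw [← dist_eq_norm] at h1 h2
  rw [← dist_eq_norm, ← dist_eq_norm] at h3
  have e : L * (ε / (8 * L)) = ε / 8 := by field_simp
  have h4 := mul_le_mul_of_nonneg_left hxx' hL.le
  have h5 := mul_le_mul_of_nonneg_left hyy' hL.le
  rw [e] at h4 h5
  rw [mul_add] at h3
  linarith [le_abs_self (fs x - fs x'), le_abs_self (gs y - gs y'),
    neg_abs_le (c x y - c x' y')]

variable [IsProbabilityMeasure P] [IsProbabilityMeasure Q] {fs : Lp ℝ 2 P} {gs : Lp ℝ 2 Q}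

theorem IsDualOptimizer.ae_isRegularPoint (hε : 0 < ε)
    (hc2 : MemLp (fun z : EuclideanSpace ℝ (Fin d) × EuclideanSpace ℝ (Fin d) => c z.1 z.2) 2
      (P.prod Q)) (hopt : IsDualOptimizer P Q c ε fs gs) :
    (∀ᵐ x ∂P, IsRegularPoint P Q c ε fs gs x) ∧
      ∀ᵐ y ∂Q, IsRegularPoint Q P (fun y x => c x y) ε gs fs y :=
  ⟨Filter.Eventually.and (Measure.support_mem_ae (μ := P)) (hopt.ae_integral_posPart_snd hε hc2),
    Filter.Eventually.and (Measure.support_mem_ae (μ := Q)) (hopt.ae_integral_posPart_fst hε hc2)⟩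

/-- Coercivity of direct sums on the set where the optimal slack is at least `ε / 2`: every
regular point has a partner with slack at least `ε`, hence this set contains the product of the
balls of radius `ε / (8 L)` around the two points, up to null sets. -/
theorem IsDualOptimizer.integral_sq_le_setIntegral (hd : 1 ≤ d) (hPconv : Convex ℝ P.support)
    (hPcomp : IsCompact P.support) {lam Lam : ℝ} (hlam : 0 < lam) (hLam : lam < Lam)
    (hPdens : HasDensityBounds P lam Lam) (hε : 0 < ε) (hL : 0 < L)
    (hc : ∀ x x' y y', |c x y - c x' y'| ≤ L * (‖x - x'‖ + ‖y - y'‖))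
    (hc2 : MemLp (fun z : EuclideanSpace ℝ (Fin d) × EuclideanSpace ℝ (Fin d) => c z.1 z.2) 2
      (P.prod Q))
    (hopt : IsDualOptimizer P Q c ε fs gs) {p q : ℝ} (hp0 : 0 < p) (hp1 : p ≤ 1) (hq0 : 0 < q)
    (hq1 : q ≤ 1) (hp : ∀ x ∈ P.support, p ≤ P.real (Metric.ball x (ε / (8 * L))))
    (hq : ∀ y ∈ Q.support, q ≤ Q.real (Metric.ball y (ε / (8 * L))))
    {u v : EuclideanSpace ℝ (Fin d) → ℝ} (hu : Measurable u) (hv : Measurable v)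
    (hu2 : MemLp u 2 P) (hv2 : MemLp v 2 Q) :
    ∫ z, (u z.1 + v z.2) ^ 2 ∂(P.prod Q) ≤
      8 * (Lam ^ 2 / lam ^ 2 * (⌈8 * L * Metric.diam P.support / ε⌉₊ : ℝ) ^ (d + 2)) / (p * q) *
        ∫ z in {z | ε / 2 ≤ fs z.1 + gs z.2 - c z.1 z.2},
          (u z.1 + v z.2) ^ 2 ∂(P.prod Q) := by
  set r := ε / (8 * L) with hr
  have hr0 : 0 < r := by positivity
  set N := ⌈8 * L * Metric.diam P.support / ε⌉₊ with hN
  have hD := hPdens.diam_support_pos hd hPcomp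
  have hN0 : N ≠ 0 := (Nat.ceil_pos.2 (by positivity)).ne'
  have hdiam : ∀ x ∈ P.support, ∀ y ∈ P.support, dist x y ≤ N * r := by
    intro x hx y hy
    have h1 := Metric.dist_le_diam_of_mem hPcomp.isBounded hx hy
    have h2 := mul_le_mul_of_nonneg_right (Nat.le_ceil (8 * L * Metric.diam P.support / ε)) hr0.le
    have h3 : 8 * L * Metric.diam P.support / ε * r = Metric.diam P.support := by
      rw [hr]; field_simp
    linarith
  have hK : 1 ≤ Lam ^ 2 / lam ^ 2 * (N : ℝ) ^ (d + 2) := by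
    have h1 : 1 ≤ Lam ^ 2 / lam ^ 2 := by
      rw [one_le_div (by positivity)]
      gcongr
    have h2 : (1 : ℝ) ≤ (N : ℝ) ^ (d + 2) :=
      one_le_pow₀ (by exact_mod_cast Nat.one_le_iff_ne_zero.2 hN0)
    nlinarith
  have hAm := measurableSet_le_slack (measurable_cost hL hc) fs gs (ε / 2)
  obtain ⟨hRP, hRQ⟩ := hopt.ae_isRegularPoint hε hc2
  refine integral_sq_oplus_le P Q hu hv hu2 hv2 hAm hp0 hp1 hq0 hq1 hK
    (hPdens.lintegral_sq_sub_le hlam (hlam.trans hLam).le hPconv hN0 hdiam hu) ?_ ?_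
  · filter_upwards [hRP] with x hx
    obtain ⟨y₀, hy₀, hslack⟩ := exists_le_of_integral_posPart_eq hε hx.2 hRQ
    filter_upwards [hRP] with x' hx' hxx'
    refine (ENNReal.ofReal_le_of_le_toReal (hq y₀ hy₀.1)).trans (measure_mono_ae ?_)
    filter_upwards [hRQ] with y hy hyball
    have hyy : dist y₀ y ≤ r := by
      rw [dist_comm]
      exact (Metric.mem_ball.1 hyball).le
    exact ⟨half_le_slack hε hL hc hx hx hy₀ hy hslack (by rw [dist_self]; exact hr0.le) hyy,
      half_le_slack hε hL hc hx hx' hy₀ hy hslack hxx' hyy⟩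
  · filter_upwards [hRQ] with y hy
    obtain ⟨x₀, hx₀, hslack⟩ := exists_le_of_integral_posPart_eq hε hy.2 hRP
    refine (ENNReal.ofReal_le_of_le_toReal (hp x₀ hx₀.1)).trans (measure_mono_ae ?_)
    filter_upwards [hRP] with x hx hxball
    have hxx : dist x₀ x ≤ r := by
      rw [dist_comm]
      exact (Metric.mem_ball.1 hxball).le
    rw [add_comm] at hslack
    exact half_le_slack hε hL hc hx₀ hx hy hy (by linarith) hxx (by rw [dist_self]; exact hr0.le)

/-- The first factor of `γ_ε` is the inverse of the lower bound on the mass of the balls of radius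
`ε / (8 L)` that the ball constant `δ` provides. -/
theorem inv_mul_max_pow (hε : 0 < ε) (hL : 0 < L) (δ : ℝ) :
    δ⁻¹ * (max (8 * L / ε) 1) ^ d = (δ * min ((ε / (8 * L)) ^ d) 1)⁻¹ := by
  have h0 : 0 < ε / (8 * L) := by positivity
  have h1 : 8 * L / ε = (ε / (8 * L))⁻¹ := by rw [inv_div]
  rw [mul_inv, h1]
  congr 1
  rcases le_total (ε / (8 * L)) 1 with h | h
  · rw [max_eq_left ((one_le_inv₀ h0).2 h), min_eq_left (pow_le_one₀ h0.le h), inv_pow]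
  · rw [max_eq_right (inv_le_one_of_one_le₀ h), min_eq_right (one_le_pow₀ h)]
    simp

theorem ae_abs_le_supNorm {X Y : Type*} [MeasurableSpace X] [MeasurableSpace Y] {P : Measure X}
    {Q : Measure Y} {w : Lp ℝ 2 (P.prod Q)} (hw : MemLp w ∞ (P.prod Q)) :
    ∀ᵐ z ∂(P.prod Q), |w z| ≤ supNorm P Q w := by
  filter_upwards [ae_le_eLpNormEssSup (f := w) (μ := P.prod Q)] with z hz
  rw [supNorm, eLpNorm_exponent_top]
  have := ENNReal.toReal_mono (by simpa [eLpNorm_exponent_top] using hw.2.ne) hz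
  simpa using this

end Euclidean

end QuadOT

/-! ### The error bound and the Polyak–Łojasiewicz inequality -/

theorem mainTheorem2 {d : ℕ} (hd : 1 ≤ d)
    (P Q : MeasureTheory.Measure (EuclideanSpace ℝ (Fin d)))
    [MeasureTheory.IsProbabilityMeasure P] [MeasureTheory.IsProbabilityMeasure Q]
    (hPconv : Convex ℝ P.support) (hPcomp : IsCompact P.support)
    (lam Lam : ℝ) (hlam : 0 < lam) (hLam : lam < Lam)
    (hPdens : QuadOT.HasDensityBounds P lam Lam)
    (hQcomp : IsCompact Q.support)
    (c : EuclideanSpace ℝ (Fin d) → EuclideanSpace ℝ (Fin d) → ℝ) (L : ℝ) (hL : 0 < L)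
    (hc : ∀ x x' y y', |c x y - c x' y'| ≤ L * (‖x - x'‖ + ‖y - y'‖))
    (ε : ℝ) (hε : 0 < ε)
    (fs : MeasureTheory.Lp ℝ 2 P) (gs : MeasureTheory.Lp ℝ 2 Q)
    (hopt : QuadOT.IsDualOptimizer P Q c ε fs gs) :
    -- an admissible constant `δ` exists, depending only on the support of `P` and on `lam`
    (∃ δ : ℝ, ∀ (P' : MeasureTheory.Measure (EuclideanSpace ℝ (Fin d))) (Lam' : ℝ),
      MeasureTheory.IsProbabilityMeasure P' → P'.support = P.support →
      QuadOT.HasDensityBounds P' lam Lam' → QuadOT.IsBallConstant P' δ) ∧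
    -- the error bound and the PL inequality, for every admissible `δ`
    ∀ δ : ℝ, QuadOT.IsBallConstant P δ →
      ∀ (f : MeasureTheory.Lp ℝ 2 P) (g : MeasureTheory.Lp ℝ 2 Q),
        MeasureTheory.MemLp f ∞ P → MeasureTheory.MemLp g ∞ Q →
        MeasureTheory.MemLp
          ((QuadOT.oplus P Q f g - QuadOT.oplus P Q fs gs : QuadOT.H P Q) :
            MeasureTheory.Lp ℝ 2 (P.prod Q)) ∞ (P.prod Q) ∧
        DifferentiableAt ℝ (QuadOT.Phi P Q c ε) (QuadOT.oplus P Q f g) ∧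
        ‖QuadOT.oplus P Q f g - QuadOT.oplus P Q fs gs‖ ≤
          QuadOT.gam P Q lam Lam L δ ε
            * max (QuadOT.supNorm P Q (QuadOT.oplus P Q f g - QuadOT.oplus P Q fs gs)) ε
            * ‖gradient (QuadOT.Phi P Q c ε) (QuadOT.oplus P Q f g)‖ ∧
        ((1 / (QuadOT.gam P Q lam Lam L δ ε
            * max (QuadOT.supNorm P Q (QuadOT.oplus P Q f g - QuadOT.oplus P Q fs gs)) ε) : ℝ) :
              EReal)
            * (QuadOT.QOT P Q c ε - (QuadOT.Phi P Q c ε (QuadOT.oplus P Q f g) : EReal)) ≤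
          ((‖gradient (QuadOT.Phi P Q c ε) (QuadOT.oplus P Q f g)‖ ^ 2 : ℝ) : EReal) := by
  refine ⟨⟨min 1 (lam * volume.real P.support / (Metric.diam P.support + 1) ^ d), ?_⟩, ?_⟩
  · intro P' Lam' hP' hsupp hdens
    rw [← hsupp]
    exact hdens.isBallConstant hlam (hsupp ▸ hPconv) (hsupp ▸ hPcomp)
  intro δ hδ f g hf hg
  have hcm := QuadOT.measurable_cost hL hc
  have hc2 := QuadOT.memLp_cost hPcomp hQcomp hL hc
  obtain ⟨hRP, hRQ⟩ := hopt.ae_isRegularPoint hε hc2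
  have hfs : MemLp fs ∞ P := QuadOT.memLp_top_of_ae_lipschitz (Lp.aestronglyMeasurable fs)
    hPcomp.isBounded (hRP.mono fun x hx => ⟨hx.1, hx⟩) hL.le fun x x' hx hx' =>
      hx.abs_sub_le hε (fun x x' y => by simpa using hc x x' y y) hx'
  have hgs : MemLp gs ∞ Q := QuadOT.memLp_top_of_ae_lipschitz (Lp.aestronglyMeasurable gs)
    hQcomp.isBounded (hRQ.mono fun y hy => ⟨hy.1, hy⟩) hL.le fun y y' hy hy' =>
      hy.abs_sub_le hε (fun y y' x => by simpa using hc x x y y') hy'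
  have hcoe := QuadOT.coeFn_oplus_sub_oplus f fs g gs
  have htop : MemLp ((QuadOT.oplus P Q f g - QuadOT.oplus P Q fs gs : QuadOT.H P Q) :
      Lp ℝ 2 (P.prod Q)) ∞ (P.prod Q) :=
    (memLp_congr_ae hcoe).2 (QuadOT.memLp_oplus (hf.sub hfs) (hg.sub hgs))
  have hgrad := QuadOT.hasGradientAt_Phi hε hc2 (QuadOT.oplus P Q f g)
  rw [hgrad.gradient]
  set m := max (QuadOT.supNorm P Q (QuadOT.oplus P Q f g - QuadOT.oplus P Q fs gs)) ε with hm
  have hεm : ε ≤ m := le_max_right _ _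
  have hm0 : 0 < m := hε.trans_le hεm
  have hbd : ∀ᵐ z ∂(P.prod Q), |(f z.1 - fs z.1) + (g z.2 - gs z.2)| ≤ m := by
    filter_upwards [QuadOT.ae_abs_le_supNorm htop, hcoe] with z h1 h2
    rw [← h2]
    exact h1.trans (le_max_left _ _)
  set r := ε / (8 * L) with hr
  have hr0 : 0 < r := by positivity
  set p := δ * min (r ^ d) 1 with hp
  have hp0 : 0 < p := mul_pos hδ.1 (lt_min (by positivity) one_pos)
  have hp1 : p ≤ 1 := mul_le_one₀ hδ.2.1 (by positivity) (min_le_right _ _)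
  set q := ⨅ y : Q.support, Q.real (Metric.ball (y : EuclideanSpace ℝ (Fin d)) r) with hq
  obtain ⟨y₀, hy₀⟩ := Measure.nonempty_support (IsProbabilityMeasure.ne_zero Q)
  have hqle : ∀ y ∈ Q.support, q ≤ Q.real (Metric.ball y r) := fun y hy =>
    ciInf_le (f := fun y : Q.support => Q.real (Metric.ball (y : EuclideanSpace ℝ (Fin d)) r))
      ⟨0, by rintro _ ⟨y, rfl⟩; exact measureReal_nonneg⟩ ⟨y, hy⟩
  have hq0 : 0 < q := by
    have : Nonempty Q.support := ⟨⟨y₀, hy₀⟩⟩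
    obtain ⟨q', hq'0, hq'⟩ := QuadOT.exists_pos_le_measureReal_ball hQcomp hr0
    exact hq'0.trans_le (le_ciInf fun y => hq' y y.2)
  have hq1 : q ≤ 1 := (hqle y₀ hy₀).trans measureReal_le_one
  set E := ∫ z in {z | ε / 2 ≤ fs z.1 + gs z.2 - c z.1 z.2},
    ((f z.1 - fs z.1) + (g z.2 - gs z.2)) ^ 2 ∂(P.prod Q) with hE
  set K := Lam ^ 2 / lam ^ 2 * (⌈8 * L * Metric.diam P.support / ε⌉₊ : ℝ) ^ (d + 2) with hK
  have hgam : QuadOT.gam P Q lam Lam L δ ε = 2 * (8 * K / (p * q)) := by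
    rw [QuadOT.gam, QuadOT.inv_mul_max_pow hε hL δ]
    change 16 * p⁻¹ * (Lam ^ 2 / lam ^ 2) *
      ((⌈8 * L * Metric.diam P.support / ε⌉₊ : ℝ) ^ (d + 2) / q) = _
    rw [hK]
    field_simp
    ring
  set h := QuadOT.oplus P Q f g - QuadOT.oplus P Q fs gs with hh
  set G := QuadOT.gradPhi hc2 ε (QuadOT.oplus P Q f g) with hG
  have hLam0 : 0 < Lam := hlam.trans hLam
  -- `γ_ε` is positive because the support of `P` is not a single point
  have hN : (0 : ℝ) < (⌈8 * L * Metric.diam P.support / ε⌉₊ : ℝ) := by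
    have := hPdens.diam_support_pos hd hPcomp
    exact_mod_cast Nat.ceil_pos.2 (by positivity)
  have hK0 : 0 < K := by positivity
  have hgam0 : 0 < QuadOT.gam P Q lam Lam L δ ε := by
    rw [hgam]
    positivity
  have hcoer : ‖h‖ ^ 2 ≤ 8 * K / (p * q) * E := by
    have h1 : ‖h‖ ^ 2 = ∫ z, ((f z.1 - fs z.1) + (g z.2 - gs z.2)) ^ 2 ∂(P.prod Q) := by
      rw [Submodule.coe_norm, QuadOT.norm_sq_eq_integral]
      exact integral_congr_ae (hcoe.mono fun z hz => by simp only [hz])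
    rw [h1]
    exact hopt.integral_sq_le_setIntegral hd hPconv hPcomp hlam hLam hPdens hε hL hc hc2 hp0 hp1
      hq0 hq1 (fun x hx => hδ.2.2 r hr0 x hx) hqle
      (u := fun x => f x - fs x) (v := fun y => g y - gs y)
      ((Lp.stronglyMeasurable f).measurable.sub (Lp.stronglyMeasurable fs).measurable)
      ((Lp.stronglyMeasurable g).measurable.sub (Lp.stronglyMeasurable gs).measurable)
      ((Lp.memLp f).sub (Lp.memLp fs)) ((Lp.memLp g).sub (Lp.memLp gs))
  have hCS : inner ℝ G (QuadOT.oplus P Q fs gs - QuadOT.oplus P Q f g) ≤ ‖G‖ * ‖h‖ := by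
    rw [hh, norm_sub_rev]
    exact real_inner_le_norm _ _
  have herr : ‖h‖ ≤ QuadOT.gam P Q lam Lam L δ ε * m * ‖G‖ := by
    have h1 := (hopt.setIntegral_sq_le_inner hε hcm hc2 f g hεm hbd).trans hCS
    have h2 : E ≤ 2 * m * (‖G‖ * ‖h‖) := by
      rw [one_div_mul_eq_div, div_le_iff₀ (by positivity)] at h1
      linarith
    have h3 : ‖h‖ * ‖h‖ ≤ QuadOT.gam P Q lam Lam L δ ε * m * ‖G‖ * ‖h‖ := by
      calc ‖h‖ * ‖h‖ = ‖h‖ ^ 2 := (sq _).symm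
        _ ≤ 8 * K / (p * q) * E := hcoer
        _ ≤ 8 * K / (p * q) * (2 * m * (‖G‖ * ‖h‖)) := by gcongr
        _ = QuadOT.gam P Q lam Lam L δ ε * m * ‖G‖ * ‖h‖ := by rw [hgam]; ring
    rcases (norm_nonneg h).eq_or_lt with h0 | h0
    · rw [← h0]
      positivity
    · exact le_of_mul_le_mul_right h3 h0
  refine ⟨htop, hgrad.differentiableAt, herr, ?_⟩
  have hgap : QuadOT.Phi P Q c ε (QuadOT.oplus P Q fs gs) -
      QuadOT.Phi P Q c ε (QuadOT.oplus P Q f g) ≤ ‖G‖ * ‖h‖ :=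
    (QuadOT.Phi_sub_le_inner hε hc2 _ _).trans hCS
  -- the primal enters only through `QOT ≤ Φ(fs ⊕ gs)`, so it suffices to bound the gap of the dual
  have hreal : 1 / (QuadOT.gam P Q lam Lam L δ ε * m) *
      (QuadOT.Phi P Q c ε (QuadOT.oplus P Q fs gs) -
        QuadOT.Phi P Q c ε (QuadOT.oplus P Q f g)) ≤ ‖G‖ ^ 2 := by
    rw [one_div_mul_eq_div, div_le_iff₀ (by positivity)]
    calc _ ≤ ‖G‖ * ‖h‖ := hgap
      _ ≤ ‖G‖ * (QuadOT.gam P Q lam Lam L δ ε * m * ‖G‖) := by gcongr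
      _ = _ := by ring
  refine le_trans ?_ (EReal.coe_le_coe_iff.2 hreal)
  rw [EReal.coe_mul, EReal.coe_sub]
  refine mul_le_mul_of_nonneg_left ?_ (EReal.coe_nonneg.2 (by positivity))
  exact EReal.sub_le_sub (hopt.QOT_le hε hcm hc2) le_rfl
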